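/- Let $\mu_0\in\mathbb R$ and $\kappa,\alpha,\beta>0$, and put on $\theta=(\mu,\lambda)$ (mean and precision) the normal-gamma prior $\mu\mid\lambda\sim N(\mu_0,(\kappa\lambda)^{-1})$, $\lambda\sim\mathrm{Gamma}(\alpha,\beta)$ ($\beta$ a rate), with density $\pi(\theta)$. For $n\ge 1$ i.i.d. observations $X_j\sim N(\mu,\lambda^{-1})$ consider the sufficient statistic $\tau=(\tau_1,\tau_2)=(\overline X,\overline{X^2})$. The joint density of $(\tau,\theta)$ is taken to be likelihood times prior, with the likelihood written as a function of $\tau$, i.e. in exponential-family form with the constant carrier $R=(2\pi)^{-n/2}$: $$f(\tau,\theta)=(2\pi)^{-n/2}\exp\Big\{n\mu\lambda\,\tau_1-\tfrac{n\lambda}{2}\tau_2-n\Big(\tfrac{\mu^2\lambda}{2}-\tfrac12\log\lambda\Big)\Big\}\,\pi(\theta),\qquad f_T(\tau)=\int f(\tau,\theta)\,d\theta .$$ Fix an observed value $\tau^*$ with $\tau_2^*>(\tau_1^*)^2$. For $\varepsilon=(\varepsilon_1,\varepsilon_2)$ with $\varepsilon_1,\varepsilon_2>0$ let $D_\varepsilon=\{\tau\in\mathbb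 R^2:\sum_{i=1}^2|(\tau_i-\tau_i^*)/\varepsilon_i|^2\le 1\}$, let $P$ be the distribution of $\theta$ with density $f(\tau^*,\theta)/f_T(\tau^*)$, and let $P^\varepsilon$ be the one with density $$\frac{|D_\varepsilon|^{-1}\int_{D_\varepsilon}f(\tau,\theta)\,d\tau}{|D_\varepsilon|^{-1}\int_{D_\varepsilon}f_T(\tau)\,d\tau}.$$ Put $$\mu_n=\frac{\kappa\mu_0+n\tau_1^*}{\kappa+n},\quad \kappa_n=\kappa+n,\quad \alpha_n=\alpha+\frac n2,\quad \beta_n=\beta+\frac n2\big(\tau_2^*-(\tau_1^*)^2\big)+\frac{\kappa n}{2(\kappa+n)}(\tau_1^*-\mu_0)^2 .$$ Then, as $n|\varepsilon|\to0$, $P$ and $P^\varepsilon$ are probability measures, the relative entropy $H(P|P^\varepsilon)=\int\log\frac{dP}{dP^\varepsilon}\,dP$ is finite, and $$\begin{aligned}H(P|P^\varepsilon)={}&\frac{n^4}{128}\varepsilon_1^4\left[\mu_n^4\frac{\alpha_n(\alpha_n+1)(4\alpha_n+6)}{\beta_n^4}+\frac{\mu_n^2}{\kappa_n}\frac{\a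lpha_n(\alpha_n+1)(4\alpha_n+12)}{\beta_n^3}+\frac1{\kappa_n^2}\frac{(2\alpha_n+3)\alpha_n}{\beta_n^2}\right]\\&+\frac{n^4}{128}\varepsilon_2^4\frac1{2^4}\frac{\alpha_n(\alpha_n+1)(4\alpha_n+6)}{\beta_n^4}\\&+\frac{n^4}{128}\varepsilon_1^2\varepsilon_2^2\frac12\left[\mu_n^2\frac{\alpha_n(\alpha_n+1)(4\alpha_n+6)}{\beta_n^4}+\frac2{\kappa_n}\frac{\alpha_n(\alpha_n+1)}{\beta_n^3}\right]+\mathcal O\big((n|\varepsilon|)^6\big),\end{aligned}$$ where $|\varepsilon|=\sqrt{\varepsilon_1^2+\varepsilon_2^2}$: there are $C,\delta>0$, depending only on $\mu_0,\kappa,\alpha,\beta,\tau^*$, such that for all $n\ge1$ and all $\varepsilon$ with $n|\varepsilon|\le\delta$ the error is at most $C(n|\varepsilon|)^6$. -/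

import Mathlib

open MeasureTheory ProbabilityTheory

namespace NormalABC

noncomputable section

/-- Hyperparameters of the normal-gamma prior: `μ ∣ λ ∼ N(μ₀, (κ λ)⁻¹)`, `λ ∼ Gamma(α, β)`
(shape `α`, rate `β`). -/
structure Prior where
  μ₀ : ℝ
  κ : ℝ
  α : ℝ
  β : ℝ
  κ_pos : 0 < κ
  α_pos : 0 < α
  β_pos : 0 < β

/-- The prior density of `θ = (μ, λ)` (mean, precision) with respect to Lebesgue measure on `ℝ × ℝ`;
it vanishes for `λ ≤ 0`. -/
def priorDensity (p : Prior) (θ : ℝ × ℝ) : ℝ :=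
  gaussianPDFReal p.μ₀ (p.κ * θ.2)⁻¹.toNNReal θ.1 * gammaPDFReal p.α p.β θ.2

/-- The canonical parameters of the normal family for the statistic
`(mean of the X_j, mean of the X_j²)`. -/
def η₁ (θ : ℝ × ℝ) : ℝ := θ.1 * θ.2

/-- See `η₁`. -/
def η₂ (θ : ℝ × ℝ) : ℝ := -θ.2 / 2

/-- The log-partition function of the normal family. -/
def logPartition (θ : ℝ × ℝ) : ℝ := θ.1 ^ 2 * θ.2 / 2 - Real.log θ.2 / 2

/-- The likelihood of `n` i.i.d. `N(μ, λ⁻¹)` observations, as a function of the statistic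
`τ = (mean of the X_j, mean of the X_j²)`, in exponential-family form with the constant carrier
`R = (2π)^(-n/2)`. -/
def likelihood (n : ℕ) (τ θ : ℝ × ℝ) : ℝ :=
  (2 * Real.pi) ^ (-(n : ℝ) / 2) *
    Real.exp (n * (η₁ θ * τ.1 + η₂ θ * τ.2) - n * logPartition θ)

/-- `likelihood` is the joint density of the sample, evaluated through the statistic. -/
theorem likelihood_eq_prod (n : ℕ) (hn : 1 ≤ n) (μ l : ℝ) (hl : 0 < l) (x : Fin n → ℝ) :
    likelihood n ((∑ j, x j) / n, (∑ j, x j ^ 2) / n) (μ, l)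
      = ∏ j, gaussianPDFReal μ l⁻¹.toNNReal (x j) := by
  have hn0 : (n : ℝ) ≠ 0 := by positivity
  have hv : ((l⁻¹.toNNReal : NNReal) : ℝ) = l⁻¹ := Real.coe_toNNReal _ (by positivity)
  have hpi : (0 : ℝ) < 2 * Real.pi := by positivity
  have hs : (Real.sqrt (2 * Real.pi * l⁻¹))⁻¹
      = Real.exp (-(Real.log (2 * Real.pi)) / 2 + Real.log l / 2) := by
    rw [Real.sqrt_eq_rpow, ← Real.rpow_neg (by positivity),
      Real.rpow_def_of_pos (by positivity), Real.log_mul hpi.ne' (by positivity), Real.log_inv]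
    congr 1
    ring
  simp only [gaussianPDFReal, hv, hs, likelihood, η₁, η₂, logPartition]
  rw [Real.rpow_def_of_pos hpi, ← Real.exp_add]
  simp only [← Real.exp_add]
  rw [← Real.exp_sum]
  congr 1
  have h : ∀ j, -(Real.log (2 * Real.pi)) / 2 + Real.log l / 2 + -(x j - μ) ^ 2 / (2 * l⁻¹)
      = (-(Real.log (2 * Real.pi)) / 2 + Real.log l / 2 - l * μ ^ 2 / 2)
        + (l * μ) * x j + (-l / 2) * x j ^ 2 := by
    intro j
    field_simp
    ring
  simp only [h, Finset.sum_add_distrib, ← Finset.mul_sum, Finset.sum_const, Finset.card_univ,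
    Fintype.card_fin, nsmul_eq_mul]
  field_simp
  ring

/-- The joint density `f(τ, θ)` of statistic and parameter. -/
def jointDensity (p : Prior) (n : ℕ) (τ θ : ℝ × ℝ) : ℝ :=
  likelihood n τ θ * priorDensity p θ

/-- The marginal density `f_T(τ) = ∫ f(τ, θ) dθ`. -/
def marginalDensity (p : Prior) (n : ℕ) (τ : ℝ × ℝ) : ℝ :=
  ∫ θ : ℝ × ℝ, jointDensity p n τ θ

/-- The exact posterior density `f(θ ∣ τ) = f(τ, θ) / f_T(τ)`. -/
def posteriorDensity (p : Prior) (n : ℕ) (τ θ : ℝ × ℝ) : ℝ :=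
  jointDensity p n τ θ / marginalDensity p n τ

/-- The elliptic acceptance region `D_ε(τ)` with semi-axes `ε.1`, `ε.2`. -/
def acceptanceRegion (ε τ : ℝ × ℝ) : Set (ℝ × ℝ) :=
  {t | ((t.1 - τ.1) / ε.1) ^ 2 + ((t.2 - τ.2) / ε.2) ^ 2 ≤ 1}

/-- The average of `g` over the acceptance region. -/
def regionAverage (ε τ : ℝ × ℝ) (g : ℝ × ℝ → ℝ) : ℝ :=
  (volume.real (acceptanceRegion ε τ))⁻¹ * ∫ t in acceptanceRegion ε τ, g t

/-- The density of the parameter accepted with region `D_ε(τ)`. -/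
def abcDensity (p : Prior) (n : ℕ) (ε τ θ : ℝ × ℝ) : ℝ :=
  regionAverage ε τ (fun t => jointDensity p n t θ) / regionAverage ε τ (marginalDensity p n)

/-- The exact posterior distribution `P`. -/
def posterior (p : Prior) (n : ℕ) (τ : ℝ × ℝ) : Measure (ℝ × ℝ) :=
  volume.withDensity fun θ => ENNReal.ofReal (posteriorDensity p n τ θ)

/-- The approximate posterior distribution `P^ε`. -/
def abcPosterior (p : Prior) (n : ℕ) (ε τ : ℝ × ℝ) : Measure (ℝ × ℝ) :=
  volume.withDensity fun θ => ENNReal.ofReal (abcDensity p n ε τ θ)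

/-- Updated prior mean. -/
def μn (p : Prior) (n : ℕ) (τ : ℝ × ℝ) : ℝ := (p.κ * p.μ₀ + n * τ.1) / (p.κ + n)

/-- Updated `κ`. -/
def κn (p : Prior) (n : ℕ) : ℝ := p.κ + n

/-- Updated shape. -/
def αn (p : Prior) (n : ℕ) : ℝ := p.α + n / 2

/-- Updated rate; `n (τ.2 - τ.1²)` is `(n - 1) S²` with `S²` the empirical variance. -/
def βn (p : Prior) (n : ℕ) (τ : ℝ × ℝ) : ℝ :=
  p.β + n * (τ.2 - τ.1 ^ 2) / 2 + p.κ * n / (2 * (p.κ + n)) * (τ.1 - p.μ₀) ^ 2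

/-- The leading-order term of the relative entropy. -/
def leadingTerm (p : Prior) (n : ℕ) (ε τ : ℝ × ℝ) : ℝ :=
  let m := μn p n τ
  let k := κn p n
  let a := αn p n
  let b := βn p n τ
  (n : ℝ) ^ 4 / 128 * ε.1 ^ 4 *
      (m ^ 4 * (a * (a + 1) * (4 * a + 6) / b ^ 4)
        + m ^ 2 / k * (a * (a + 1) * (4 * a + 12) / b ^ 3)
        + 1 / k ^ 2 * ((2 * a + 3) * a / b ^ 2))
    + (n : ℝ) ^ 4 / 128 * ε.2 ^ 4 * (1 / 2 ^ 4) * (a * (a + 1) * (4 * a + 6) / b ^ 4)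
    + (n : ℝ) ^ 4 / 128 * ε.1 ^ 2 * ε.2 ^ 2 * (1 / 2) *
      (m ^ 2 * (a * (a + 1) * (4 * a + 6) / b ^ 4) + 2 / k * (a * (a + 1) / b ^ 3))

end

end NormalABC

/-! The log-likelihood is affine in the statistic, so moving `τ` to `τ + ε x` multiplies the joint
density by the exponential of a linear form in `x` with coefficients `n ε.1 η₁`, `n ε.2 η₂`
(`jointDensity_shift`). Averaging over the ellipse shows that `P^ε` has density `A / E_P A` with
respect to `P`, where `A` is the average of that exponential over the unit disk
(`abcPosterior_eq_tilted`). The entropy is therefore the Jensen gap `log E_P A - E_P log A`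
(`klDiv_tilted`).

By central symmetry only even orders survive in `A`. With `s` the squared length of the coefficient
vector, `A = 1 + s/8 + s²/192 + O(s³)` and `log A = s/8 - s²/384 + O(s³)`, so the gap is
`Var_P(s)/128` up to third order in `s` (`Controlled.abs_log_integral_sub_le`). By conjugacy `P` is
normal-gamma with updated hyperparameters (`posterior_eq`), and the variance is an explicit
polynomial in gamma and Gaussian moments (`variance_scaledSq_eq_leadingTerm`).

The remainder must be uniform in `n`. Since `s ≤ (ρ W)²` with `ρ = n|ε|` and `W = |η₁| + |η₂|`, it
is enough to bound one exponential moment of `W` along all the posteriors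
(`exists_exp_moment_bound`). This works because `μn` and `αn / βn` stay bounded and `κn ≥ κ`; the
hypothesis `τ.1² < τ.2` makes `βn` grow linearly, like `αn`. -/

namespace NormalABC

noncomputable section

/-! ### Pointwise expansion of the logarithm of a disk average. -/

/-- Second-order expansion of the logarithm, on the whole half-line. -/
theorem abs_log_one_add_sub_le {x : ℝ} (hx : 0 ≤ x) :
    |Real.log (1 + x) - (x - x ^ 2 / 2)| ≤ 2 * x ^ 3 := by
  have h3 : 0 ≤ x ^ 3 := by positivity
  have hlow : x - x ^ 2 / 2 ≤ Real.log (1 + x) := by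
    refine le_trans ?_ (Real.le_log_one_add_of_nonneg hx)
    rw [le_div_iff₀ (by positivity)]
    nlinarith
  have hup : Real.log (1 + x) ≤ x - x ^ 2 / 2 + 2 * x ^ 3 := by
    -- Away from zero the cubic term absorbs `x² / 2`, so `log (1 + x) ≤ x` is enough. Near zero the
    -- Taylor remainder is at most `x³ / (1 - x)`.
    rcases le_or_gt (1 / 2) x with h | h
    · have := Real.log_le_sub_one_of_pos (show 0 < 1 + x by positivity)
      nlinarith [mul_nonneg (sq_nonneg x) (sub_nonneg.2 h)]
    · have h1 := Real.abs_log_sub_add_sum_range_le (x := -x)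
        (by rw [abs_neg, abs_of_nonneg hx]; linarith) 2
      rw [abs_neg, abs_of_nonneg hx] at h1
      have h2 : x ^ (2 + 1) / (1 - x) ≤ 2 * x ^ 3 := by
        rw [div_le_iff₀ (by linarith)]
        change x ^ 3 ≤ _
        nlinarith [mul_nonneg h3 (show 0 ≤ 1 - 2 * x by linarith)]
      have h4 := (abs_le.1 (h1.trans h2)).2
      norm_num [Finset.sum_range_succ] at h4
      linarith
  rw [abs_le]
  constructor <;> linarith

/-- The bounds satisfied by the average of `exp` of a linear form of squared length `s` over the
unit disk. -/
structure DiskBounds (s A : ℝ) : Prop where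
  lower : 1 + s / 8 + s ^ 2 / 192 ≤ A
  upper : A ≤ 1 + s / 8 + s ^ 2 / 192 + s ^ 3 * Real.exp (Real.sqrt s) / 720
  le_exp : A ≤ Real.exp (Real.sqrt s)

theorem DiskBounds.one_le {s A : ℝ} (h : DiskBounds s A) (hs : 0 ≤ s) : 1 ≤ A := by
  have := h.lower
  nlinarith [sq_nonneg s]

theorem DiskBounds.log_nonneg {s A : ℝ} (h : DiskBounds s A) (hs : 0 ≤ s) : 0 ≤ Real.log A :=
  Real.log_nonneg (h.one_le hs)

theorem DiskBounds.log_le {s A : ℝ} (h : DiskBounds s A) (hs : 0 ≤ s) :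
    Real.log A ≤ Real.sqrt s := by
  rw [Real.log_le_iff_le_exp (by linarith [h.one_le hs])]
  exact h.le_exp

/-- The coefficient of `s²` is `1/192 - (1/8)²/2 = -1/384`. The bound has to hold for all `s ≥ 0`
because it is integrated later; for `s > 1` the crude `0 ≤ log A ≤ √s` is dominated by `s³`. -/
theorem DiskBounds.abs_log_sub_le {s A : ℝ} (h : DiskBounds s A) (hs : 0 ≤ s) :
    |Real.log A - (s / 8 - s ^ 2 / 384)| ≤ 2 * s ^ 3 := by
  rcases le_or_gt s 1 with h1 | h1
  · have hl := h.lower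
    have hu := h.upper
    have he : Real.exp (Real.sqrt s) ≤ 3 := by
      have : Real.exp (Real.sqrt s) ≤ Real.exp 1 :=
        Real.exp_le_exp.2 (Real.sqrt_le_one.2 h1)
      linarith [Real.exp_one_lt_d9]
    have h3 : 0 ≤ s ^ 3 := by positivity
    have hr : s ^ 3 * Real.exp (Real.sqrt s) / 720 ≤ s ^ 3 / 200 := by
      have := mul_le_mul_of_nonneg_left he h3
      linarith
    have h21 : s ^ 3 ≤ s ^ 2 := by nlinarith [sq_nonneg s]
    have h10 : s ^ 2 ≤ s := by nlinarith
    obtain ⟨x, rfl⟩ : ∃ x, A = 1 + x := ⟨A - 1, by ring⟩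
    have hx0 : 0 ≤ x := by nlinarith [sq_nonneg s]
    have hx1 : x ≤ s / 2 := by linarith
    have hlog := abs_le.1 (abs_log_one_add_sub_le hx0)
    have hx3 : x ^ 3 ≤ (s / 2) ^ 3 := pow_le_pow_left₀ hx0 hx1 3
    have hd0 : 0 ≤ x - s / 8 := by nlinarith [sq_nonneg s]
    have hd1 : x - s / 8 ≤ s ^ 2 := by linarith
    have hsq0 : 0 ≤ (x - s / 8) * (x + s / 8) := mul_nonneg hd0 (by linarith)
    have hsq1 : (x - s / 8) * (x + s / 8) ≤ s ^ 2 * s :=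
      mul_le_mul hd1 (by linarith) (by linarith) (sq_nonneg s)
    rw [abs_le]
    constructor <;> nlinarith
  · have h0 := h.log_nonneg hs
    have h2 := h.log_le hs
    have h4 : Real.sqrt s ≤ s := by
      rw [Real.sqrt_le_left hs]
      nlinarith
    have h12 : s ≤ s ^ 2 := by nlinarith
    have h23 : s ^ 2 ≤ s ^ 3 := by nlinarith [sq_nonneg s]
    rw [abs_le]
    constructor <;> linarith

theorem pow_le_factorial_div_mul_exp {c w : ℝ} (hc : 0 < c) (hw : 0 ≤ w) (j : ℕ) :
    w ^ j ≤ j.factorial / c ^ j * Real.exp (c * w) := by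
  have h := Real.pow_div_factorial_le_exp (c * w) (by positivity) j
  rw [div_le_iff₀ (by positivity), mul_pow] at h
  rw [div_mul_eq_mul_div, le_div_iff₀ (by positivity)]
  linarith

/-! ### The Jensen gap under an exponential moment. -/

section Controlled

variable {Ω : Type*} [MeasurableSpace Ω]

/-- The hypotheses under which the relative entropy between `P` and its reweighting by `A` is
expanded: `A` is a disk average of size `s`, and `s` is controlled by `ρ W` with `W` having a
uniform exponential moment. -/
structure Controlled (P : Measure Ω) (c K ρ : ℝ) (W s A : Ω → ℝ) : Prop where
  ρ_nonneg : 0 ≤ ρ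
  ρ_le : ρ ≤ c
  W_nonneg : ∀ ω, 0 ≤ W ω
  s_nonneg : ∀ ω, 0 ≤ s ω
  s_le : ∀ ω, s ω ≤ (ρ * W ω) ^ 2
  bounds : ∀ ω, DiskBounds (s ω) (A ω)
  measurable_s : Measurable s
  measurable_A : Measurable A
  integrable_exp : Integrable (fun ω => Real.exp (2 * c * W ω)) P
  integral_exp_le : ∫ ω, Real.exp (2 * c * W ω) ∂P ≤ K

namespace Controlled

variable {P : Measure Ω} {c K ρ : ℝ} {W s A : Ω → ℝ}

theorem sqrt_le (h : Controlled P c K ρ W s A) (ω : Ω) : Real.sqrt (s ω) ≤ ρ * W ω :=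
  Real.sqrt_le_iff.2 ⟨mul_nonneg h.ρ_nonneg (h.W_nonneg ω), h.s_le ω⟩

theorem exp_sqrt_le (h : Controlled P c K ρ W s A) (ω : Ω) :
    Real.exp (Real.sqrt (s ω)) ≤ Real.exp (c * W ω) :=
  Real.exp_le_exp.2 ((h.sqrt_le ω).trans
    (mul_le_mul_of_nonneg_right h.ρ_le (h.W_nonneg ω)))

theorem exp_le (h : Controlled P c K ρ W s A) (hc : 0 < c) (ω : Ω) :
    Real.exp (c * W ω) ≤ Real.exp (2 * c * W ω) :=
  Real.exp_le_exp.2 (by nlinarith [mul_nonneg hc.le (h.W_nonneg ω)])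

/-- The exponent `2c` is spent in halves: one `exp (c W)` absorbs the power `W ^ (2j)`, the other
dominates `exp √s` because `ρ ≤ c`. -/
theorem pow_mul_exp_le (h : Controlled P c K ρ W s A) (hc : 0 < c) (j : ℕ) (ω : Ω) :
    s ω ^ j * Real.exp (Real.sqrt (s ω))
      ≤ (2 * j).factorial / c ^ (2 * j) * ρ ^ (2 * j) * Real.exp (2 * c * W ω) := by
  have hW := h.W_nonneg ω
  have h1 : s ω ^ j ≤ ρ ^ (2 * j) * W ω ^ (2 * j) := by
    rw [← mul_pow, pow_mul]
    exact pow_le_pow_left₀ (h.s_nonneg ω) (h.s_le ω) j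
  have h2 := pow_le_factorial_div_mul_exp hc hW (2 * j)
  have hρ := pow_nonneg h.ρ_nonneg (2 * j)
  have h3 : s ω ^ j ≤ ρ ^ (2 * j) * ((2 * j).factorial / c ^ (2 * j) * Real.exp (c * W ω)) :=
    h1.trans (mul_le_mul_of_nonneg_left h2 hρ)
  calc s ω ^ j * Real.exp (Real.sqrt (s ω))
      ≤ ρ ^ (2 * j) * ((2 * j).factorial / c ^ (2 * j) * Real.exp (c * W ω))
          * Real.exp (c * W ω) :=
        mul_le_mul h3 (h.exp_sqrt_le ω) (Real.exp_pos _).le (by positivity)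
    _ = _ := by
        rw [show 2 * c * W ω = c * W ω + c * W ω by ring, Real.exp_add]
        ring

theorem integrable_pow_mul_exp (h : Controlled P c K ρ W s A) (hc : 0 < c) (j : ℕ) :
    Integrable (fun ω => s ω ^ j * Real.exp (Real.sqrt (s ω))) P := by
  refine (h.integrable_exp.const_mul ((2 * j).factorial / c ^ (2 * j) * ρ ^ (2 * j))).mono'
    ?_ (ae_of_all _ fun ω => ?_)
  · have := h.measurable_s
    exact Measurable.aestronglyMeasurable (by fun_prop)
  · rw [Real.norm_of_nonneg (mul_nonneg (pow_nonneg (h.s_nonneg ω) j) (Real.exp_pos _).le)]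
    exact h.pow_mul_exp_le hc j ω

theorem integral_pow_mul_exp_le (h : Controlled P c K ρ W s A) (hc : 0 < c) (j : ℕ) :
    ∫ ω, s ω ^ j * Real.exp (Real.sqrt (s ω)) ∂P
      ≤ (2 * j).factorial / c ^ (2 * j) * K * ρ ^ (2 * j) := by
  have hρ := pow_nonneg h.ρ_nonneg (2 * j)
  calc _ ≤ ∫ ω, (2 * j).factorial / c ^ (2 * j) * ρ ^ (2 * j) * Real.exp (2 * c * W ω) ∂P :=
        integral_mono (h.integrable_pow_mul_exp hc j) (h.integrable_exp.const_mul _)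
          (h.pow_mul_exp_le hc j)
    _ ≤ (2 * j).factorial / c ^ (2 * j) * ρ ^ (2 * j) * K := by
        rw [integral_const_mul]
        exact mul_le_mul_of_nonneg_left h.integral_exp_le (by positivity)
    _ = _ := by ring

theorem pow_le_pow_mul_exp (h : Controlled P c K ρ W s A) (j : ℕ) (ω : Ω) :
    s ω ^ j ≤ s ω ^ j * Real.exp (Real.sqrt (s ω)) :=
  le_mul_of_one_le_right (pow_nonneg (h.s_nonneg ω) j) (Real.one_le_exp (Real.sqrt_nonneg _))

theorem integrable_pow (h : Controlled P c K ρ W s A) (hc : 0 < c) (j : ℕ) :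
    Integrable (fun ω => s ω ^ j) P := by
  refine (h.integrable_pow_mul_exp hc j).mono' (h.measurable_s.pow_const j).aestronglyMeasurable
    (ae_of_all _ fun ω => ?_)
  rw [Real.norm_of_nonneg (pow_nonneg (h.s_nonneg ω) j)]
  exact h.pow_le_pow_mul_exp j ω

theorem integral_pow_le (h : Controlled P c K ρ W s A) (hc : 0 < c) (j : ℕ) :
    ∫ ω, s ω ^ j ∂P ≤ (2 * j).factorial / c ^ (2 * j) * K * ρ ^ (2 * j) :=
  (integral_mono (h.integrable_pow hc j) (h.integrable_pow_mul_exp hc j)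
    (h.pow_le_pow_mul_exp j)).trans (h.integral_pow_mul_exp_le hc j)

theorem integrable_A (h : Controlled P c K ρ W s A) (hc : 0 < c) : Integrable A P := by
  refine h.integrable_exp.mono' h.measurable_A.aestronglyMeasurable (ae_of_all _ fun ω => ?_)
  rw [Real.norm_of_nonneg (by linarith [(h.bounds ω).one_le (h.s_nonneg ω)])]
  exact (h.bounds ω).le_exp.trans ((h.exp_sqrt_le ω).trans (h.exp_le hc ω))

theorem integrable_log (h : Controlled P c K ρ W s A) (hc : 0 < c) :
    Integrable (fun ω => Real.log (A ω)) P := by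
  refine (h.integrable_A hc).mono' h.measurable_A.log.aestronglyMeasurable
    (ae_of_all _ fun ω => ?_)
  rw [Real.norm_of_nonneg ((h.bounds ω).log_nonneg (h.s_nonneg ω))]
  have h1 := (h.bounds ω).one_le (h.s_nonneg ω)
  linarith [Real.log_le_sub_one_of_pos (show 0 < A ω by linarith)]

/-- The relative entropy is the variance of `s` divided by `128`, up to sixth order in `ρ`. -/
theorem abs_log_integral_sub_le [IsProbabilityMeasure P] (h : Controlled P c K ρ W s A)
    (hc : 0 < c) {B : ℝ} (hB1 : 2 / c ^ 2 * K ≤ B) (hB2 : 24 / c ^ 4 * K ≤ B)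
    (hB3 : 720 / c ^ 6 * K ≤ B) :
    |Real.log (∫ ω, A ω ∂P) - ∫ ω, Real.log (A ω) ∂P
        - (∫ ω, s ω ^ 2 ∂P - (∫ ω, s ω ∂P) ^ 2) / 128|
      ≤ (3 * B + (B * (1 + c ^ 2 + c ^ 4)) ^ 2 + 2 * (B * (1 + c ^ 2 + c ^ 4)) ^ 3) * ρ ^ 6 := by
  have i1 : Integrable s P := by simpa using h.integrable_pow hc 1
  have i2 := h.integrable_pow hc 2
  have i3 := h.integrable_pow hc 3
  have i3e := h.integrable_pow_mul_exp hc 3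
  have iA := h.integrable_A hc
  have iL := h.integrable_log hc
  set S1 := ∫ ω, s ω ∂P
  set S2 := ∫ ω, s ω ^ 2 ∂P
  set S3 := ∫ ω, s ω ^ 3 ∂P
  set T := ∫ ω, s ω ^ 3 * Real.exp (Real.sqrt (s ω)) ∂P
  have hρ := h.ρ_nonneg
  have hS1 : S1 ≤ B * ρ ^ 2 := by
    have := h.integral_pow_le hc 1
    norm_num [Nat.factorial] at this
    exact this.trans (mul_le_mul_of_nonneg_right hB1 (by positivity))
  have hS2 : S2 ≤ B * ρ ^ 4 := by
    have := h.integral_pow_le hc 2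
    norm_num [Nat.factorial] at this
    exact this.trans (mul_le_mul_of_nonneg_right hB2 (by positivity))
  have hT : T ≤ B * ρ ^ 6 := by
    have := h.integral_pow_mul_exp_le hc 3
    norm_num [Nat.factorial] at this
    exact this.trans (mul_le_mul_of_nonneg_right hB3 (by positivity))
  have hS3 : S3 ≤ B * ρ ^ 6 :=
    (integral_mono i3 i3e (h.pow_le_pow_mul_exp 3)).trans hT
  have hS1n : 0 ≤ S1 := integral_nonneg h.s_nonneg
  have hS2n : 0 ≤ S2 := integral_nonneg fun ω => sq_nonneg _
  have hlow : 1 + S1 / 8 + S2 / 192 ≤ ∫ ω, A ω ∂P := by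
    have e : ∫ ω, (1 + s ω / 8 + s ω ^ 2 / 192) ∂P = 1 + S1 / 8 + S2 / 192 := by
      rw [integral_add (by fun_prop) (by fun_prop), integral_add (by fun_prop) (by fun_prop),
        integral_div, integral_div]
      simp [S1, S2]
    rw [← e]
    exact integral_mono (by fun_prop) iA fun ω => (h.bounds ω).lower
  have hupp : ∫ ω, A ω ∂P ≤ 1 + S1 / 8 + S2 / 192 + T / 720 := by
    have e : ∫ ω, (1 + s ω / 8 + s ω ^ 2 / 192 + s ω ^ 3 * Real.exp (Real.sqrt (s ω)) / 720) ∂P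
        = 1 + S1 / 8 + S2 / 192 + T / 720 := by
      rw [integral_add (by fun_prop) (by fun_prop),
        integral_add (by fun_prop) (by fun_prop), integral_add (by fun_prop) (by fun_prop),
        integral_div, integral_div, integral_div]
      simp [S1, S2, T]
    rw [← e]
    exact integral_mono iA (by fun_prop) fun ω => (h.bounds ω).upper
  have hlog : |∫ ω, Real.log (A ω) ∂P - (S1 / 8 - S2 / 384)| ≤ 2 * S3 := by
    have e : ∫ ω, (Real.log (A ω) - (s ω / 8 - s ω ^ 2 / 384)) ∂P
        = ∫ ω, Real.log (A ω) ∂P - (S1 / 8 - S2 / 384) := by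
      rw [integral_sub iL (by fun_prop), integral_sub (by fun_prop) (by fun_prop),
        integral_div, integral_div]
    rw [← e, ← integral_const_mul]
    refine (abs_integral_le_integral_abs).trans
      (integral_mono (by fun_prop) (by fun_prop) fun ω => ?_)
    exact (h.bounds ω).abs_log_sub_le (h.s_nonneg ω)
  obtain ⟨y, hy⟩ : ∃ y, ∫ ω, A ω ∂P = 1 + y := ⟨∫ ω, A ω ∂P - 1, by ring⟩
  rw [hy] at hlow hupp ⊢
  have hy0 : 0 ≤ y := by linarith
  have hexp := abs_le.1 (abs_log_one_add_sub_le hy0)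
  have hl := abs_le.1 hlog
  -- Excess powers of `ρ` are traded for powers of `c`, which is where the factor `1 + c² + c⁴`
  -- comes from.
  have hρc : ρ ^ 2 ≤ c ^ 2 := pow_le_pow_left₀ hρ h.ρ_le 2
  have hρc4 : ρ ^ 4 ≤ c ^ 4 := pow_le_pow_left₀ hρ h.ρ_le 4
  have hBρ : 0 ≤ B * ρ ^ 2 := hS1n.trans hS1
  have hBρ4 : 0 ≤ B * ρ ^ 4 := hS2n.trans hS2
  have hB4 : B * ρ ^ 4 ≤ B * ρ ^ 2 * c ^ 2 := by
    rw [show B * ρ ^ 4 = B * ρ ^ 2 * ρ ^ 2 by ring]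
    exact mul_le_mul_of_nonneg_left hρc hBρ
  have hB6 : B * ρ ^ 6 ≤ B * ρ ^ 2 * c ^ 4 := by
    rw [show B * ρ ^ 6 = B * ρ ^ 2 * ρ ^ 4 by ring]
    exact mul_le_mul_of_nonneg_left hρc4 hBρ
  have hB6' : B * ρ ^ 6 ≤ B * ρ ^ 4 * c ^ 2 := by
    rw [show B * ρ ^ 6 = B * ρ ^ 4 * ρ ^ 2 by ring]
    exact mul_le_mul_of_nonneg_left hρc hBρ4
  have hBρ6 : 0 ≤ B * ρ ^ 6 := by
    rw [show B * ρ ^ 6 = B * ρ ^ 4 * ρ ^ 2 by ring]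
    positivity
  set B' := B * (1 + c ^ 2 + c ^ 4) with hB'
  have hyB : y ≤ B' * ρ ^ 2 := by
    rw [show B' * ρ ^ 2 = B * ρ ^ 2 + B * ρ ^ 2 * c ^ 2 + B * ρ ^ 2 * c ^ 4 by rw [hB']; ring]
    linarith
  have hc2 : 0 ≤ B * ρ ^ 4 * c ^ 4 := by positivity
  have hd : y - S1 / 8 ≤ B' * ρ ^ 4 := by
    rw [show B' * ρ ^ 4 = B * ρ ^ 4 + B * ρ ^ 4 * c ^ 2 + B * ρ ^ 4 * c ^ 4 by rw [hB']; ring]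
    linarith
  have hd0 : 0 ≤ y - S1 / 8 := by linarith
  have hsum : y + S1 / 8 ≤ 2 * (B' * ρ ^ 2) := by linarith
  -- In `log (1 + y)` the square `y²` may be replaced by `(S1/8)²` at sixth-order cost: the
  -- difference factors into terms of orders `ρ⁴` and `ρ²`.
  have hprod : (y - S1 / 8) * (y + S1 / 8) ≤ B' * ρ ^ 4 * (2 * (B' * ρ ^ 2)) :=
    mul_le_mul hd hsum (by linarith) (hd0.trans hd)
  have hprod0 : 0 ≤ (y - S1 / 8) * (y + S1 / 8) := mul_nonneg hd0 (by linarith)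
  have hy3 : y ^ 3 ≤ (B' * ρ ^ 2) ^ 3 := pow_le_pow_left₀ hy0 hyB 3
  have e1 : B' * ρ ^ 4 * (2 * (B' * ρ ^ 2)) = 2 * (B' ^ 2 * ρ ^ 6) := by ring
  have e2 : (B' * ρ ^ 2) ^ 3 = B' ^ 3 * ρ ^ 6 := by ring
  have e3 : (3 * B + B' ^ 2 + 2 * B' ^ 3) * ρ ^ 6
      = 3 * (B * ρ ^ 6) + B' ^ 2 * ρ ^ 6 + 2 * (B' ^ 3 * ρ ^ 6) := by ring
  have e4 : (y - S1 / 8) * (y + S1 / 8) = y ^ 2 - S1 ^ 2 / 64 := by ring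
  rw [e1, e4] at hprod
  rw [e4] at hprod0
  rw [e2] at hy3
  rw [e3, abs_le]
  constructor <;> linarith

end Controlled

end Controlled

/-! ### Averages over the unit disk. -/

/-- The closed unit disk of the plane. -/
def unitDisk : Set (ℝ × ℝ) := {x | x.1 ^ 2 + x.2 ^ 2 ≤ 1}

theorem isCompact_unitDisk : IsCompact unitDisk := by
  refine IsCompact.of_isClosed_subset (isCompact_Icc (a := ((-1, -1) : ℝ × ℝ)) (b := (1, 1)))
    (isClosed_le (by fun_prop) (by fun_prop)) ?_
  rintro ⟨x, y⟩ h
  simp only [unitDisk, Set.mem_ofPred_eq] at h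
  have hx : |x| ≤ 1 := by rw [← sq_le_one_iff_abs_le_one]; nlinarith [sq_nonneg y]
  have hy : |y| ≤ 1 := by rw [← sq_le_one_iff_abs_le_one]; nlinarith [sq_nonneg x]
  rw [abs_le] at hx hy
  exact ⟨⟨hx.1, hy.1⟩, ⟨hx.2, hy.2⟩⟩

theorem measurableSet_unitDisk : MeasurableSet unitDisk := isCompact_unitDisk.measurableSet

/-- Polar coordinates separate the variables; the Jacobian turns `r ^ k` into `r ^ (k + 1)`, whose
integral over `[0, 1]` is `1 / (k + 2)`. -/
theorem setIntegral_unitDisk_of_homogeneous (k : ℕ) (F : ℝ × ℝ → ℝ) (G : ℝ → ℝ)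
    (h : ∀ r t, F (r * Real.cos t, r * Real.sin t) = r ^ k * G t) :
    ∫ x in unitDisk, F x = 1 / (k + 2) * ∫ t in (-Real.pi)..Real.pi, G t := by
  have hr : ∫ r in Set.Ioi (0 : ℝ), (Set.Iic (1 : ℝ)).indicator (fun r => r ^ (k + 1)) r
      = 1 / (k + 2) := by
    rw [setIntegral_indicator measurableSet_Iic, Set.Ioi_inter_Iic,
      ← intervalIntegral.integral_of_le zero_le_one, integral_pow]
    push_cast
    simp
    ring
  rw [← integral_indicator measurableSet_unitDisk, ← integral_comp_polarCoord_symm,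
    polarCoord_target]
  rw [intervalIntegral.integral_of_le (by linarith [Real.pi_pos]), integral_Ioc_eq_integral_Ioo,
    ← hr, Measure.volume_eq_prod, ← setIntegral_prod_mul]
  refine setIntegral_congr_fun (measurableSet_Ioi.prod measurableSet_Ioo) fun z hz => ?_
  have hz0 : 0 < z.1 := hz.1
  have hmem : (z.1 * Real.cos z.2, z.1 * Real.sin z.2) ∈ unitDisk ↔ z.1 ∈ Set.Iic (1 : ℝ) := by
    simp only [unitDisk, Set.mem_ofPred_eq, Set.mem_Iic]
    rw [show (z.1 * Real.cos z.2) ^ 2 + (z.1 * Real.sin z.2) ^ 2 = z.1 ^ 2 by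
      rw [mul_pow, mul_pow, ← mul_add, Real.cos_sq_add_sin_sq, mul_one]]
    rw [sq_le_one_iff_abs_le_one, abs_of_pos hz0]
  simp only [polarCoord_symm_apply, smul_eq_mul]
  by_cases hz1 : z.1 ∈ Set.Iic (1 : ℝ)
  · rw [Set.indicator_of_mem (hmem.2 hz1), Set.indicator_of_mem hz1, h]
    ring
  · rw [Set.indicator_of_notMem (mt hmem.1 hz1), Set.indicator_of_notMem hz1, mul_zero, zero_mul]

/-- Writing `(a, b)` in polar form turns the integrand into `R² cos² (t - φ)`; over a full period
the phase drops out. -/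
theorem integral_linear_cos_sin_sq (a b : ℝ) :
    ∫ t in (-Real.pi)..Real.pi, (a * Real.cos t + b * Real.sin t) ^ 2
      = Real.pi * (a ^ 2 + b ^ 2) := by
  obtain ⟨R, φ, rfl, rfl⟩ : ∃ R φ : ℝ, a = R * Real.cos φ ∧ b = R * Real.sin φ :=
    ⟨‖(⟨a, b⟩ : ℂ)‖, Complex.arg ⟨a, b⟩, (Complex.norm_mul_cos_arg ⟨a, b⟩).symm,
      (Complex.norm_mul_sin_arg ⟨a, b⟩).symm⟩
  have e : ∀ t, (R * Real.cos φ * Real.cos t + R * Real.sin φ * Real.sin t) ^ 2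
      = R ^ 2 * Real.cos (t - φ) ^ 2 := fun t => by rw [Real.cos_sub]; ring
  simp_rw [e]
  rw [intervalIntegral.integral_const_mul,
    intervalIntegral.integral_comp_sub_right (fun t => Real.cos t ^ 2), integral_cos_sq,
    mul_pow, mul_pow, ← mul_add, Real.cos_sq_add_sin_sq, ← Real.cos_neg (-Real.pi - φ),
    ← neg_neg (Real.sin (-Real.pi - φ)), ← Real.sin_neg (-Real.pi - φ), neg_sub, sub_neg_eq_add,
    Real.cos_add_pi, Real.sin_add_pi, Real.cos_pi_sub, Real.sin_pi_sub]
  ring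

theorem integral_linear_cos_sin_pow_four (a b : ℝ) :
    ∫ t in (-Real.pi)..Real.pi, (a * Real.cos t + b * Real.sin t) ^ 4
      = 3 / 4 * Real.pi * (a ^ 2 + b ^ 2) ^ 2 := by
  obtain ⟨R, φ, rfl, rfl⟩ : ∃ R φ : ℝ, a = R * Real.cos φ ∧ b = R * Real.sin φ :=
    ⟨‖(⟨a, b⟩ : ℂ)‖, Complex.arg ⟨a, b⟩, (Complex.norm_mul_cos_arg ⟨a, b⟩).symm,
      (Complex.norm_mul_sin_arg ⟨a, b⟩).symm⟩
  have e : ∀ t, (R * Real.cos φ * Real.cos t + R * Real.sin φ * Real.sin t) ^ 4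
      = R ^ 4 * Real.cos (t - φ) ^ (2 + 2) := fun t => by rw [Real.cos_sub]; ring
  simp_rw [e]
  rw [intervalIntegral.integral_const_mul,
    intervalIntegral.integral_comp_sub_right (fun t => Real.cos t ^ (2 + 2)), integral_cos_pow,
    integral_cos_sq,
    mul_pow, mul_pow, ← mul_add, Real.cos_sq_add_sin_sq, ← Real.cos_neg (-Real.pi - φ),
    ← neg_neg (Real.sin (-Real.pi - φ)), ← Real.sin_neg (-Real.pi - φ), neg_sub, sub_neg_eq_add,
    Real.cos_add_pi, Real.sin_add_pi, Real.cos_pi_sub, Real.sin_pi_sub]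
  push_cast
  ring

theorem setIntegral_unitDisk_one : ∫ _x in unitDisk, (1 : ℝ) = Real.pi := by
  rw [setIntegral_unitDisk_of_homogeneous 0 (fun _ => 1) (fun _ => 1) (by simp)]
  simp
  ring

theorem setIntegral_unitDisk_linear_sq (a b : ℝ) :
    ∫ x in unitDisk, (a * x.1 + b * x.2) ^ 2 = Real.pi * ((a ^ 2 + b ^ 2) / 4) := by
  rw [setIntegral_unitDisk_of_homogeneous 2 _ (fun t => (a * Real.cos t + b * Real.sin t) ^ 2)
    (fun r t => by ring), integral_linear_cos_sin_sq]
  push_cast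
  ring

theorem setIntegral_unitDisk_linear_pow_four (a b : ℝ) :
    ∫ x in unitDisk, (a * x.1 + b * x.2) ^ 4 = Real.pi * ((a ^ 2 + b ^ 2) ^ 2 / 8) := by
  rw [setIntegral_unitDisk_of_homogeneous 4 _ (fun t => (a * Real.cos t + b * Real.sin t) ^ 4)
    (fun r t => by ring), integral_linear_cos_sin_pow_four]
  push_cast
  ring

/-- The average of a function over the unit disk. -/
def diskAverage (g : ℝ × ℝ → ℝ) : ℝ := Real.pi⁻¹ * ∫ x in unitDisk, g x

theorem integrableOn_unitDisk {g : ℝ × ℝ → ℝ} (hg : Continuous g) : IntegrableOn g unitDisk :=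
  hg.continuousOn.integrableOn_compact isCompact_unitDisk

theorem diskAverage_add {f g : ℝ × ℝ → ℝ} (hf : Continuous f) (hg : Continuous g) :
    diskAverage (fun x => f x + g x) = diskAverage f + diskAverage g := by
  rw [diskAverage, integral_add (integrableOn_unitDisk hf) (integrableOn_unitDisk hg), mul_add]
  rfl

theorem diskAverage_div (f : ℝ × ℝ → ℝ) (c : ℝ) :
    diskAverage (fun x => f x / c) = diskAverage f / c := by
  rw [diskAverage, integral_div, diskAverage, mul_div_assoc]

theorem diskAverage_mono {f g : ℝ × ℝ → ℝ} (hf : Continuous f) (hg : Continuous g)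
    (h : ∀ x ∈ unitDisk, f x ≤ g x) : diskAverage f ≤ diskAverage g :=
  mul_le_mul_of_nonneg_left (setIntegral_mono_on (integrableOn_unitDisk hf)
    (integrableOn_unitDisk hg) measurableSet_unitDisk h) (by positivity)

theorem diskAverage_const (c : ℝ) : diskAverage (fun _ => c) = c := by
  have h : ∫ _x in unitDisk, c = ∫ _x in unitDisk, c * (1 : ℝ) := by simp
  rw [diskAverage, h, integral_const_mul, setIntegral_unitDisk_one]
  field_simp

theorem diskAverage_linear_sq (a b : ℝ) :
    diskAverage (fun x => (a * x.1 + b * x.2) ^ 2) = (a ^ 2 + b ^ 2) / 4 := by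
  rw [diskAverage, setIntegral_unitDisk_linear_sq]
  field_simp

theorem diskAverage_linear_pow_four (a b : ℝ) :
    diskAverage (fun x => (a * x.1 + b * x.2) ^ 4) = (a ^ 2 + b ^ 2) ^ 2 / 8 := by
  rw [diskAverage, setIntegral_unitDisk_linear_pow_four]
  field_simp

theorem diskAverage_comp_neg (g : ℝ × ℝ → ℝ) : diskAverage (fun x => g (-x)) = diskAverage g := by
  rw [diskAverage, diskAverage, ← integral_indicator measurableSet_unitDisk,
    ← integral_indicator measurableSet_unitDisk, ← integral_neg_eq_self]
  congr 2 with x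
  simp [Set.indicator_apply, unitDisk]

/-- The disk is centrally symmetric, so the odd part of the exponential averages to zero. -/
theorem diskAverage_exp_eq_cosh (a b : ℝ) :
    diskAverage (fun x => Real.exp (a * x.1 + b * x.2))
      = diskAverage (fun x => Real.cosh (a * x.1 + b * x.2)) := by
  simp_rw [Real.cosh_eq]
  rw [diskAverage_div, diskAverage_add (by fun_prop) (by fun_prop)]
  have h := diskAverage_comp_neg fun x => Real.exp (a * x.1 + b * x.2)
  have e : ∀ x : ℝ × ℝ, Real.exp (a * (-x).1 + b * (-x).2) = Real.exp (-(a * x.1 + b * x.2)) :=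
    fun x => by congr 1; simp; ring
  simp_rw [e] at h
  rw [h]
  ring

theorem le_cosh (u : ℝ) : 1 + u ^ 2 / 2 + u ^ 4 / 24 ≤ Real.cosh u := by
  have h := sum_le_hasSum (Finset.range 3) (fun i _ => by rw [pow_mul]; positivity)
    (Real.hasSum_cosh u)
  norm_num [Finset.sum_range_succ, Nat.factorial] at h
  linarith

/-- The tail of the series is compared term by term with `u⁶ / 720` times the whole series, using
`6! (2n)! ≤ (2n + 6)!`. -/
theorem cosh_le (u : ℝ) :
    Real.cosh u ≤ 1 + u ^ 2 / 2 + u ^ 4 / 24 + u ^ 6 / 720 * Real.cosh u := by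
  have h := (hasSum_nat_add_iff' 3).2 (Real.hasSum_cosh u)
  have h2 := (Real.hasSum_cosh u).mul_left (u ^ 6 / 720)
  have h3 := hasSum_le (fun n => ?_) h h2
  · norm_num [Finset.sum_range_succ, Nat.factorial] at h3
    linarith
  · have hf : ((720 * (2 * n).factorial : ℕ) : ℝ) ≤ ((2 * (n + 3)).factorial : ℕ) := by
      have := Nat.le_of_dvd (Nat.factorial_pos _)
        (Nat.factorial_mul_factorial_dvd_factorial_add 6 (2 * n))
      rw [show 2 * (n + 3) = 6 + 2 * n by ring]
      exact_mod_cast this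
    push_cast at hf
    rw [div_mul_div_comm, ← pow_add, show 6 + 2 * n = 2 * (n + 3) by ring]
    refine div_le_div_of_nonneg_left ?_ (by positivity) hf
    rw [pow_mul]
    positivity

theorem abs_linear_le_sqrt {a b : ℝ} {x : ℝ × ℝ} (hx : x ∈ unitDisk) :
    |a * x.1 + b * x.2| ≤ Real.sqrt (a ^ 2 + b ^ 2) := by
  apply Real.abs_le_sqrt
  have hx' : x.1 ^ 2 + x.2 ^ 2 ≤ 1 := hx
  nlinarith [sq_nonneg (a * x.2 - b * x.1),
    mul_nonneg (add_nonneg (sq_nonneg a) (sq_nonneg b)) (sub_nonneg.2 hx')]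

theorem cosh_le_exp_abs (u : ℝ) : Real.cosh u ≤ Real.exp |u| := by
  rw [← Real.cosh_abs, Real.cosh_eq]
  have : Real.exp (-|u|) ≤ Real.exp |u| := Real.exp_le_exp.2 (by linarith [abs_nonneg u])
  linarith

/-- The linear form has second and fourth disk moments `s/4` and `s²/8`; divided by `2!` and `4!`
they give `s/8` and `s²/192`. -/
theorem diskBounds_diskAverage_exp (a b : ℝ) :
    DiskBounds (a ^ 2 + b ^ 2) (diskAverage fun x => Real.exp (a * x.1 + b * x.2)) := by
  set s := a ^ 2 + b ^ 2 with hs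
  have hs0 : 0 ≤ s := by positivity
  have hexp : ∀ x ∈ unitDisk, Real.cosh (a * x.1 + b * x.2) ≤ Real.exp (Real.sqrt s) :=
    fun x hx => (cosh_le_exp_abs _).trans (Real.exp_le_exp.2 (abs_linear_le_sqrt hx))
  have hpoly : diskAverage (fun x : ℝ × ℝ => 1 + (a * x.1 + b * x.2) ^ 2 / 2
      + (a * x.1 + b * x.2) ^ 4 / 24) = 1 + s / 8 + s ^ 2 / 192 := by
    rw [diskAverage_add (by fun_prop) (by fun_prop), diskAverage_add (by fun_prop) (by fun_prop),
      diskAverage_div, diskAverage_div, diskAverage_const, diskAverage_linear_sq,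
      diskAverage_linear_pow_four]
    ring
  rw [diskAverage_exp_eq_cosh]
  refine ⟨?_, ?_, ?_⟩
  · rw [← hpoly]
    exact diskAverage_mono (by fun_prop) (by fun_prop) fun x _ => le_cosh _
  · rw [← hpoly, ← diskAverage_const (s ^ 3 * Real.exp (Real.sqrt s) / 720),
      ← diskAverage_add (by fun_prop) (by fun_prop)]
    refine diskAverage_mono (by fun_prop) (by fun_prop) fun x hx => (cosh_le _).trans ?_
    have h6 : (a * x.1 + b * x.2) ^ 6 ≤ s ^ 3 := by
      have h2 : (a * x.1 + b * x.2) ^ 2 ≤ s := by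
        rw [← sq_abs, ← Real.sq_sqrt hs0]
        exact pow_le_pow_left₀ (abs_nonneg _) (abs_linear_le_sqrt hx) 2
      rw [show (a * x.1 + b * x.2) ^ 6 = ((a * x.1 + b * x.2) ^ 2) ^ 3 by ring]
      exact pow_le_pow_left₀ (sq_nonneg _) h2 3
    have := mul_le_mul h6 (hexp x hx) (Real.cosh_pos _).le (by positivity)
    linarith
  · rw [← diskAverage_const (Real.exp (Real.sqrt s))]
    exact diskAverage_mono (by fun_prop) (by fun_prop) hexp

/-! ### From the ellipse to the unit disk. -/

theorem map_volume_add_mul (t : ℝ) {e : ℝ} (he : 0 < e) :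
    Measure.map (fun x => t + e * x) volume = ENNReal.ofReal e⁻¹ • (volume : Measure ℝ) := by
  rw [← Function.comp_def (fun x => t + x) (fun x => e * x),
    ← Measure.map_map (by fun_prop) (by fun_prop), Real.map_volume_mul_left he.ne',
    Measure.map_smul, map_add_left_eq_self, abs_of_pos (inv_pos.2 he)]

/-- The affine map that takes the unit disk to the acceptance region. -/
def regionMap (ε τ x : ℝ × ℝ) : ℝ × ℝ := (τ.1 + ε.1 * x.1, τ.2 + ε.2 * x.2)

theorem setIntegral_unitDisk_comp_regionMap {ε : ℝ × ℝ} (h1 : 0 < ε.1) (h2 : 0 < ε.2) (τ : ℝ × ℝ)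
    (g : ℝ × ℝ → ℝ) :
    ∫ x in unitDisk, g (regionMap ε τ x)
      = (ε.1 * ε.2)⁻¹ * ∫ t in acceptanceRegion ε τ, g t := by
  have hinj : Function.Injective (regionMap ε τ) := by
    rintro ⟨x, y⟩ ⟨x', y'⟩ h
    simpa [regionMap, h1.ne', h2.ne'] using h
  have hcont : Continuous (regionMap ε τ) := by unfold regionMap; fun_prop
  have hemb : MeasurableEmbedding (regionMap ε τ) := hcont.measurableEmbedding hinj
  have hmap : Measure.map (regionMap ε τ) volume
      = ENNReal.ofReal (ε.1 * ε.2)⁻¹ • (volume : Measure (ℝ × ℝ)) := by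
    have h := Measure.map_prod_map (f := fun x : ℝ => τ.1 + ε.1 * x)
      (g := fun x : ℝ => τ.2 + ε.2 * x) volume volume (by fun_prop) (by fun_prop)
    rw [map_volume_add_mul _ h1, map_volume_add_mul _ h2, Measure.prod_smul_left,
      Measure.prod_smul_right, smul_smul, ← ENNReal.ofReal_mul (by positivity), ← mul_inv] at h
    exact h.symm
  have hpre : regionMap ε τ ⁻¹' acceptanceRegion ε τ = unitDisk := by
    ext x
    simp [regionMap, acceptanceRegion, unitDisk, h1.ne', h2.ne']
  have h := hemb.setIntegral_map (μ := volume) g (acceptanceRegion ε τ)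
  rw [hpre, hmap, Measure.restrict_smul, integral_smul_measure,
    ENNReal.toReal_ofReal (by positivity), smul_eq_mul] at h
  exact h.symm

theorem regionAverage_eq_diskAverage {ε : ℝ × ℝ} (h1 : 0 < ε.1) (h2 : 0 < ε.2) (τ : ℝ × ℝ)
    (g : ℝ × ℝ → ℝ) : regionAverage ε τ g = diskAverage fun x => g (regionMap ε τ x) := by
  -- The constant function `1` gives the area `π ε.1 ε.2` of the ellipse, so the Jacobian cancels in
  -- the average.
  have hv := setIntegral_unitDisk_comp_regionMap h1 h2 τ fun _ => 1
  rw [setIntegral_unitDisk_one, setIntegral_const, smul_eq_mul, mul_one] at hv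
  rw [regionAverage, diskAverage, setIntegral_unitDisk_comp_regionMap h1 h2, hv]
  field_simp

/-! ### Moments of the gamma law. -/

theorem gammaMeasure_eq_restrict_withDensity (a b : ℝ) :
    gammaMeasure a b = (volume.restrict (Set.Ioi 0)).withDensity fun x =>
      ENNReal.ofReal (b ^ a / Real.Gamma a * x ^ (a - 1) * Real.exp (-(b * x))) := by
  rw [← withDensity_indicator measurableSet_Ioi, gammaMeasure]
  refine withDensity_congr_ae ?_
  have h0 : ∀ᵐ x : ℝ, x ≠ 0 := by simp [ae_iff]
  filter_upwards [h0] with x hx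
  rcases lt_or_gt_of_ne hx with h | h
  · rw [gammaPDF_of_neg h, Set.indicator_of_notMem (by simpa using h.le)]
  · rw [gammaPDF_of_nonneg h.le, Set.indicator_of_mem (Set.mem_Ioi.2 h)]

theorem ae_pos_gammaMeasure (a b : ℝ) : ∀ᵐ x ∂gammaMeasure a b, 0 < x := by
  rw [gammaMeasure_eq_restrict_withDensity]
  exact (withDensity_absolutelyContinuous _ _).ae_le (ae_restrict_mem measurableSet_Ioi)

section GammaMoments

variable {a b : ℝ}

theorem integral_gammaMeasure (ha : 0 < a) (hb : 0 < b) (g : ℝ → ℝ) :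
    ∫ x, g x ∂gammaMeasure a b
      = ∫ x in Set.Ioi 0, b ^ a / Real.Gamma a * x ^ (a - 1) * Real.exp (-(b * x)) * g x := by
  rw [gammaMeasure_eq_restrict_withDensity, integral_withDensity_eq_integral_toReal_smul
    (by fun_prop) (by simp)]
  refine setIntegral_congr_fun measurableSet_Ioi fun x (hx : 0 < x) => ?_
  have := Real.Gamma_pos_of_pos ha
  simp only [smul_eq_mul]
  rw [ENNReal.toReal_ofReal (by positivity)]

/-- The Bochner integral of a non-integrable function is `0` by convention, so a nonzero value
certifies integrability. -/
theorem integrable_gammaMeasure_of_integral_ne_zero {g : ℝ → ℝ}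
    (h : ∫ x, g x ∂gammaMeasure a b ≠ 0) : Integrable g (gammaMeasure a b) :=
  not_imp_comm.1 integral_undef h

/-- Euler's integral with rate `b - c`. The case `c = 0` gives the moments, `q = 0` the moment
generating function. -/
theorem integral_rpow_mul_exp_gammaMeasure (ha : 0 < a) (hb : 0 < b) {q c : ℝ} (hq : 0 ≤ q)
    (hc : c < b) :
    ∫ x, x ^ q * Real.exp (c * x) ∂gammaMeasure a b
      = b ^ a / Real.Gamma a * ((1 / (b - c)) ^ (a + q) * Real.Gamma (a + q)) := by
  rw [integral_gammaMeasure ha hb, ← Real.integral_rpow_mul_exp_neg_mul_Ioi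
    (show 0 < a + q by positivity) (sub_pos.2 hc), ← integral_const_mul]
  refine setIntegral_congr_fun measurableSet_Ioi fun x (hx : 0 < x) => ?_
  rw [show a + q - 1 = (a - 1) + q by ring, Real.rpow_add hx,
    show -((b - c) * x) = -(b * x) + c * x by ring, Real.exp_add]
  ring

theorem integrable_rpow_gammaMeasure (ha : 0 < a) (hb : 0 < b) {q : ℝ} (hq : 0 ≤ q) :
    Integrable (fun x => x ^ q) (gammaMeasure a b) := by
  apply integrable_gammaMeasure_of_integral_ne_zero
  have h := integral_rpow_mul_exp_gammaMeasure ha hb hq hb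
  simp only [zero_mul, Real.exp_zero, mul_one, sub_zero] at h
  rw [h]
  have := Real.Gamma_pos_of_pos ha
  have := Real.Gamma_pos_of_pos (show 0 < a + q by positivity)
  positivity

theorem integrable_pow_mul_sqrt_pow_gammaMeasure (ha : 0 < a) (hb : 0 < b) (i j : ℕ) :
    Integrable (fun x => x ^ i * Real.sqrt x ^ j) (gammaMeasure a b) := by
  refine (integrable_rpow_gammaMeasure ha hb (q := i + j / 2) (by positivity)).congr ?_
  filter_upwards [ae_pos_gammaMeasure a b] with x hx
  rw [Real.rpow_add hx, Real.rpow_natCast, Real.sqrt_eq_rpow, ← Real.rpow_natCast _ j,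
    ← Real.rpow_mul hx.le]
  congr 2
  ring

theorem integral_pow_gammaMeasure (ha : 0 < a) (hb : 0 < b) (j : ℕ) :
    ∫ x, x ^ j ∂gammaMeasure a b = Real.Gamma (a + j) / Real.Gamma a / b ^ j := by
  have h := integral_rpow_mul_exp_gammaMeasure ha hb (Nat.cast_nonneg j) hb
  simp only [zero_mul, Real.exp_zero, mul_one, sub_zero, Real.rpow_natCast] at h
  have h1 := (Real.Gamma_pos_of_pos ha).ne'
  rw [h, one_div, Real.inv_rpow hb.le, Real.rpow_add hb, Real.rpow_natCast]
  field_simp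

theorem Gamma_add_natCast_succ (ha : 0 < a) (j : ℕ) :
    Real.Gamma (a + (j + 1 : ℕ)) = (a + j) * Real.Gamma (a + j) := by
  rw [← Real.Gamma_add_one (by positivity)]
  push_cast
  ring_nf

theorem integral_pow_succ_gammaMeasure (ha : 0 < a) (hb : 0 < b) (j : ℕ) :
    ∫ x, x ^ (j + 1) ∂gammaMeasure a b = (a + j) / b * ∫ x, x ^ j ∂gammaMeasure a b := by
  rw [integral_pow_gammaMeasure ha hb, integral_pow_gammaMeasure ha hb,
    Gamma_add_natCast_succ ha, pow_succ]
  field_simp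

theorem integral_pow_one_gammaMeasure (ha : 0 < a) (hb : 0 < b) :
    ∫ x, x ^ 1 ∂gammaMeasure a b = a / b := by
  have := isProbabilityMeasure_gammaMeasure ha hb
  rw [← zero_add 1, integral_pow_succ_gammaMeasure ha hb]
  simp

theorem integral_sq_gammaMeasure (ha : 0 < a) (hb : 0 < b) :
    ∫ x, x ^ 2 ∂gammaMeasure a b = a * (a + 1) / b ^ 2 := by
  rw [integral_pow_succ_gammaMeasure ha hb 1, integral_pow_one_gammaMeasure ha hb]
  push_cast
  field_simp

theorem integral_pow_three_gammaMeasure (ha : 0 < a) (hb : 0 < b) :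
    ∫ x, x ^ 3 ∂gammaMeasure a b = a * (a + 1) * (a + 2) / b ^ 3 := by
  rw [integral_pow_succ_gammaMeasure ha hb 2, integral_sq_gammaMeasure ha hb]
  push_cast
  field_simp

theorem integral_pow_four_gammaMeasure (ha : 0 < a) (hb : 0 < b) :
    ∫ x, x ^ 4 ∂gammaMeasure a b = a * (a + 1) * (a + 2) * (a + 3) / b ^ 4 := by
  rw [integral_pow_succ_gammaMeasure ha hb 3, integral_pow_three_gammaMeasure ha hb]
  push_cast
  field_simp

theorem integral_exp_mul_gammaMeasure (ha : 0 < a) (hb : 0 < b) {c : ℝ} (hc : c < b) :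
    ∫ x, Real.exp (c * x) ∂gammaMeasure a b = (b / (b - c)) ^ a := by
  have h := integral_rpow_mul_exp_gammaMeasure ha hb le_rfl hc
  have h1 := (Real.Gamma_pos_of_pos ha).ne'
  simp only [Real.rpow_zero, one_mul, add_zero] at h
  rw [h, one_div, Real.inv_rpow (sub_pos.2 hc).le, Real.div_rpow hb.le (sub_pos.2 hc).le]
  field_simp

theorem integrable_exp_mul_gammaMeasure (ha : 0 < a) (hb : 0 < b) {c : ℝ} (hc : c < b) :
    Integrable (fun x => Real.exp (c * x)) (gammaMeasure a b) := by
  apply integrable_gammaMeasure_of_integral_ne_zero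
  rw [integral_exp_mul_gammaMeasure ha hb hc]
  have := sub_pos.2 hc
  positivity

/-- For `c ≤ b/2` one has `b / (b - c) ≤ 1 + 2c/b`. The bound sees the shape only through `a / b`,
which stays bounded along the posteriors while the shape grows with `n`. -/
theorem integral_exp_mul_gammaMeasure_le (ha : 0 < a) (hb : 0 < b) {c : ℝ} (hc0 : 0 ≤ c)
    (hc : c ≤ b / 2) :
    ∫ x, Real.exp (c * x) ∂gammaMeasure a b ≤ Real.exp (2 * c * (a / b)) := by
  have hbc : 0 < b - c := by linarith
  rw [integral_exp_mul_gammaMeasure ha hb (by linarith)]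
  have h1 : b / (b - c) ≤ Real.exp (2 * c / b) := by
    refine le_trans ?_ (Real.add_one_le_exp _)
    rw [div_le_iff₀ hbc]
    have : (2 * c / b + 1) * (b - c) = b + c * (b - 2 * c) / b := by field_simp; ring
    rw [this]
    have : 0 ≤ c * (b - 2 * c) / b := by
      have : 0 ≤ b - 2 * c := by linarith
      positivity
    linarith
  calc (b / (b - c)) ^ a ≤ Real.exp (2 * c / b) ^ a :=
        Real.rpow_le_rpow (by positivity) h1 ha.le
    _ = Real.exp (2 * c * (a / b)) := by
        rw [← Real.exp_mul]
        congr 1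
        ring

end GammaMoments

/-! ### Moments of the standard Gaussian. -/

section GaussianMoments

theorem integrable_pow_gaussianReal (j : ℕ) :
    Integrable (fun z : ℝ => z ^ j) (gaussianReal 0 1) := by
  have h := (memLp_id_gaussianReal (μ := 0) (v := 1) j).integrable_norm_pow'
  refine h.mono' (by fun_prop) (ae_of_all _ fun z => ?_)
  simp

theorem integral_pow_gaussianReal_of_odd {j : ℕ} (hj : Odd j) :
    ∫ z : ℝ, z ^ j ∂gaussianReal 0 1 = 0 := by
  have h : ∫ z : ℝ, z ^ j ∂(gaussianReal 0 1).map (fun x => -x)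
      = ∫ z : ℝ, (-z) ^ j ∂gaussianReal 0 1 :=
    integral_map (by fun_prop) (by fun_prop)
  rw [gaussianReal_map_neg, neg_zero] at h
  simp_rw [hj.neg_pow, integral_neg] at h
  linarith

theorem integral_sq_gaussianReal : ∫ z : ℝ, z ^ 2 ∂gaussianReal 0 1 = 1 := by
  have h := variance_fun_id_gaussianReal (μ := 0) (v := 1)
  rw [variance_of_integral_eq_zero (by fun_prop) integral_id_gaussianReal] at h
  simpa using h

theorem integral_pow_four_gaussianReal : ∫ z : ℝ, z ^ 4 ∂gaussianReal 0 1 = 3 := by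
  rw [integral_gaussianReal_eq_integral_smul one_ne_zero]
  have h := integral_rpow_mul_exp_neg_mul_rpow (p := 2) (q := 4) (b := 1 / 2)
    (by norm_num) (by norm_num) (by norm_num)
  have hG : Real.Gamma ((4 + 1) / 2) = 3 / 4 * Real.sqrt Real.pi := by
    rw [show ((4 : ℝ) + 1) / 2 = (1 / 2 + 1) + 1 by norm_num, Real.Gamma_add_one (by norm_num),
      Real.Gamma_add_one (by norm_num), Real.Gamma_one_half_eq]
    ring
  have h2 : ((1 : ℝ) / 2) ^ (-(4 + 1 : ℝ) / 2) = 4 * Real.sqrt 2 := by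
    rw [one_div, Real.inv_rpow (by norm_num), ← Real.rpow_neg (by norm_num),
      show -(-(4 + 1 : ℝ) / 2) = (2 : ℕ) + 1 / 2 by norm_num, Real.rpow_add (by norm_num),
      Real.rpow_natCast, Real.sqrt_eq_rpow]
    norm_num
  rw [hG, h2] at h
  have e : ∀ z : ℝ, gaussianPDFReal 0 1 z • z ^ 4
      = (Real.sqrt (2 * Real.pi))⁻¹ * (|z| ^ (4 : ℝ) * Real.exp (-(1 / 2) * |z| ^ (2 : ℝ))) := by
    intro z
    rw [show (4 : ℝ) = (4 : ℕ) by norm_num, Real.rpow_natCast, Even.pow_abs (by decide),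
      show (2 : ℝ) = (2 : ℕ) by norm_num, Real.rpow_natCast, sq_abs, gaussianPDFReal, smul_eq_mul]
    simp
    rw [show -(2⁻¹ * z ^ 2) = -z ^ 2 / 2 by ring]
    ring
  simp_rw [e]
  rw [integral_const_mul, integral_comp_abs (f := fun x : ℝ =>
    x ^ (4 : ℝ) * Real.exp (-(1 / 2) * x ^ (2 : ℝ))), h, Real.sqrt_mul (by norm_num)]
  field_simp

theorem integrable_exp_sq_gaussianReal :
    Integrable (fun z : ℝ => Real.exp (z ^ 2 / 4)) (gaussianReal 0 1) := by
  rw [gaussianReal_of_var_ne_zero _ one_ne_zero,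
    integrable_withDensity_iff_integrable_smul' (by fun_prop) (by simp [gaussianPDF_lt_top])]
  refine ((integrable_exp_neg_mul_sq (b := 1 / 4) (by norm_num)).const_mul
    (Real.sqrt (2 * Real.pi))⁻¹).congr (ae_of_all _ fun z => ?_)
  simp only [toReal_gaussianPDF, gaussianPDFReal, smul_eq_mul]
  rw [mul_assoc, ← Real.exp_add]
  simp
  left
  ring

end GaussianMoments

/-! ### The normal-gamma law and its standardisation. -/

/-- The normal-gamma distribution. -/
def normalGamma (p : Prior) : Measure (ℝ × ℝ) :=
  volume.withDensity fun θ => ENNReal.ofReal (priorDensity p θ)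

theorem measurable_priorDensity (p : Prior) : Measurable (priorDensity p) := by
  unfold priorDensity
  refine Measurable.mul ?_ (by fun_prop)
  exact measurable_uncurry_gaussianPDFReal.comp
    (f := fun θ : ℝ × ℝ => (p.μ₀, (p.κ * θ.2)⁻¹.toNNReal, θ.1)) (by fun_prop)

theorem priorDensity_nonneg (p : Prior) (θ : ℝ × ℝ) : 0 ≤ priorDensity p θ :=
  mul_nonneg (gaussianPDFReal_nonneg _ _ _) (gammaPDFReal_nonneg p.α_pos p.β_pos _)

/-- The standardised form of a normal-gamma vector. -/
def standardMap (p : Prior) (x : ℝ × ℝ) : ℝ × ℝ := (p.μ₀ + (Real.sqrt (p.κ * x.1))⁻¹ * x.2, x.1)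

theorem measurable_standardMap (p : Prior) : Measurable (standardMap p) := by
  unfold standardMap; fun_prop

/-- The law of precision and standardised mean. -/
def standardLaw (p : Prior) : Measure (ℝ × ℝ) := (gammaMeasure p.α p.β).prod (gaussianReal 0 1)

instance (p : Prior) : IsProbabilityMeasure (gammaMeasure p.α p.β) :=
  isProbabilityMeasure_gammaMeasure p.α_pos p.β_pos

instance (p : Prior) : IsProbabilityMeasure (standardLaw p) := by
  unfold standardLaw; infer_instance

theorem gaussianReal_eq_map_standard (m : ℝ) {v : ℝ} (hv : 0 < v) :
    gaussianReal m v⁻¹.toNNReal = (gaussianReal 0 1).map fun z => m + (Real.sqrt v)⁻¹ * z := by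
  rw [← Function.comp_def (fun x => m + x) (fun x => (Real.sqrt v)⁻¹ * x),
    ← Measure.map_map (by fun_prop) (by fun_prop), gaussianReal_map_const_mul,
    gaussianReal_map_const_add]
  congr 1
  · simp
  · ext
    simp [Real.sq_sqrt hv.le, hv.le]

/-- Conditionally on the precision, the mean is an affine image of a standard Gaussian; this
replaces the joint law by a product measure. -/
theorem normalGamma_eq_map (p : Prior) : normalGamma p = (standardLaw p).map (standardMap p) := by
  refine Measure.ext_of_lintegral _ fun f hf => ?_
  have hm := measurable_standardMap p
  have hpd := measurable_priorDensity p
  have hin : Measurable fun l => ∫⁻ z, f (standardMap p (l, z)) ∂gaussianReal 0 1 :=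
    Measurable.lintegral_prod_right' (hf.comp hm)
  rw [lintegral_map hf hm, standardLaw, lintegral_prod _ (by fun_prop), normalGamma,
    lintegral_withDensity_eq_lintegral_mul _ (by fun_prop) hf, Measure.volume_eq_prod,
    lintegral_prod_symm _ (by fun_prop), gammaMeasure,
    lintegral_withDensity_eq_lintegral_mul _ (by unfold gammaPDF; fun_prop)
      hin]
  refine lintegral_congr_ae ?_
  have h0 : ∀ᵐ x : ℝ, x ≠ 0 := by simp [ae_iff]
  filter_upwards [h0] with l hl
  rcases lt_or_gt_of_ne hl with h | h
  · have hz : ∀ x, priorDensity p (x, l) = 0 := fun x => by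
      simp [priorDensity, gammaPDFReal, not_le.2 h]
    simp [hz, gammaPDF_of_neg h]
  · have hv : (p.κ * l)⁻¹.toNNReal ≠ 0 := by
      have := p.κ_pos
      simp only [ne_eq, Real.toNNReal_eq_zero, not_le]
      positivity
    have hfl : Measurable fun x => f (x, l) := by fun_prop
    have e : ∀ x, ENNReal.ofReal (priorDensity p (x, l)) * f (x, l)
        = gammaPDF p.α p.β l * (gaussianPDF p.μ₀ (p.κ * l)⁻¹.toNNReal x * f (x, l)) := fun x => by
      rw [priorDensity, ENNReal.ofReal_mul (gaussianPDFReal_nonneg _ _ _), gammaPDF, gaussianPDF]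
      ring
    simp only [Pi.mul_apply, e]
    rw [lintegral_const_mul _ (by fun_prop)]
    congr 1
    have h2 := lintegral_withDensity_eq_lintegral_mul volume
      (measurable_gaussianPDF p.μ₀ (p.κ * l)⁻¹.toNNReal) hfl
    rw [← gaussianReal_of_var_ne_zero _ hv,
      gaussianReal_eq_map_standard _ (mul_pos p.κ_pos h), lintegral_map hfl (by fun_prop)] at h2
    exact h2.symm

instance (p : Prior) : IsProbabilityMeasure (normalGamma p) := by
  rw [normalGamma_eq_map]
  exact Measure.isProbabilityMeasure_map (measurable_standardMap p).aemeasurable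

theorem integral_normalGamma (p : Prior) {g : ℝ × ℝ → ℝ} (hg : Measurable g) :
    ∫ θ, g θ ∂normalGamma p = ∫ x, g (standardMap p x) ∂standardLaw p := by
  rw [normalGamma_eq_map,
    integral_map (measurable_standardMap p).aemeasurable hg.aestronglyMeasurable]

theorem integrable_normalGamma_iff (p : Prior) {g : ℝ × ℝ → ℝ} (hg : Measurable g) :
    Integrable g (normalGamma p) ↔ Integrable (fun x => g (standardMap p x)) (standardLaw p) := by
  rw [normalGamma_eq_map, integrable_map_measure hg.aestronglyMeasurable
    (measurable_standardMap p).aemeasurable]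
  rfl

theorem ae_standardLaw_pos (p : Prior) : ∀ᵐ x ∂standardLaw p, 0 < x.1 :=
  Measure.quasiMeasurePreserving_fst.ae (ae_pos_gammaMeasure p.α p.β)

/-- In standard coordinates `η₁` is a polynomial in `x.1`, `√x.1` and `x.2`, so its moments factor.
-/
theorem η₁_standardMap (p : Prior) {x : ℝ × ℝ} (hx : 0 < x.1) :
    η₁ (standardMap p x) = p.μ₀ * x.1 + (Real.sqrt p.κ)⁻¹ * (Real.sqrt x.1 * x.2) := by
  have hκ := Real.sqrt_pos.2 p.κ_pos
  have hs := Real.sqrt_pos.2 hx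
  have hxx : x.1 = Real.sqrt x.1 * Real.sqrt x.1 := (Real.mul_self_sqrt hx.le).symm
  simp only [η₁, standardMap, Real.sqrt_mul p.κ_pos.le]
  rw [add_mul]
  congr 1
  nth_rewrite 2 [hxx]
  field_simp

theorem η₂_standardMap (p : Prior) (x : ℝ × ℝ) : η₂ (standardMap p x) = -x.1 / 2 := rfl

theorem measurable_η₁ : Measurable η₁ := by unfold η₁; fun_prop

theorem measurable_η₂ : Measurable η₂ := by unfold η₂; fun_prop

/-! ### Mean and second moment of the squared length. -/

/-- Monomials in the precision and the scaled standardised mean. -/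
def monomial (i j : ℕ) (x : ℝ × ℝ) : ℝ := x.1 ^ i * Real.sqrt x.1 ^ j * x.2 ^ j

theorem integrable_monomial (p : Prior) (i j : ℕ) : Integrable (monomial i j) (standardLaw p) :=
  (integrable_pow_mul_sqrt_pow_gammaMeasure p.α_pos p.β_pos i j).mul_prod
    (integrable_pow_gaussianReal j)

theorem integral_monomial_of_odd (p : Prior) (i : ℕ) {j : ℕ} (hj : Odd j) :
    ∫ x, monomial i j x ∂standardLaw p = 0 := by
  unfold monomial standardLaw
  rw [integral_prod_mul (fun l : ℝ => l ^ i * Real.sqrt l ^ j) (fun z => z ^ j),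
    integral_pow_gaussianReal_of_odd hj, mul_zero]

theorem integral_monomial_of_even (p : Prior) (i j : ℕ) :
    ∫ x, monomial i (2 * j) x ∂standardLaw p
      = (∫ l, l ^ (i + j) ∂gammaMeasure p.α p.β) * ∫ z, z ^ (2 * j) ∂gaussianReal 0 1 := by
  unfold monomial standardLaw
  rw [integral_prod_mul (fun l : ℝ => l ^ i * Real.sqrt l ^ (2 * j)) (fun z => z ^ (2 * j))]
  congr 1
  refine integral_congr_ae ?_
  filter_upwards [ae_pos_gammaMeasure p.α p.β] with l hl
  rw [pow_mul, Real.sq_sqrt hl.le, pow_add]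

/-- The squared length of the canonical parameter, scaled by `u` in both coordinates. -/
def scaledSq (u θ : ℝ × ℝ) : ℝ := (u.1 * η₁ θ) ^ 2 + (u.2 * η₂ θ) ^ 2

theorem scaledSq_nonneg (u θ : ℝ × ℝ) : 0 ≤ scaledSq u θ := by unfold scaledSq; positivity

theorem measurable_scaledSq (u : ℝ × ℝ) : Measurable (scaledSq u) := by
  have := measurable_η₁
  have := measurable_η₂
  unfold scaledSq
  fun_prop

theorem inv_sqrt_sq (p : Prior) : (Real.sqrt p.κ)⁻¹ ^ 2 = 1 / p.κ := by
  rw [inv_pow, Real.sq_sqrt p.κ_pos.le, one_div]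

theorem integral_scaledSq (p : Prior) (u : ℝ × ℝ) :
    ∫ θ, scaledSq u θ ∂normalGamma p
      = u.1 ^ 2 * (p.μ₀ ^ 2 * (p.α * (p.α + 1) / p.β ^ 2) + p.α / p.β / p.κ)
        + u.2 ^ 2 / 4 * (p.α * (p.α + 1) / p.β ^ 2) := by
  have hr := inv_sqrt_sq p
  set r := (Real.sqrt p.κ)⁻¹
  rw [integral_normalGamma p (measurable_scaledSq u)]
  -- Exponents are kept as `2 * 0` and `2 * 1` to match `integral_monomial_of_even`; the odd
  -- monomial integrates to zero.
  have e : ∀ᵐ x ∂standardLaw p, scaledSq u (standardMap p x)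
      = (u.1 ^ 2 * p.μ₀ ^ 2 + u.2 ^ 2 / 4) * monomial 2 (2 * 0) x
        + u.1 ^ 2 * (2 * p.μ₀ * r) * monomial 1 1 x
        + u.1 ^ 2 * r ^ 2 * monomial 0 (2 * 1) x := by
    filter_upwards [ae_standardLaw_pos p] with x hx
    rw [scaledSq, η₁_standardMap p hx, η₂_standardMap]
    simp only [monomial]
    ring
  have h20 := integrable_monomial p 2 (2 * 0)
  have h11 := integrable_monomial p 1 1
  have h02 := integrable_monomial p 0 (2 * 1)
  rw [integral_congr_ae e, integral_add (by fun_prop) (by fun_prop),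
    integral_add (by fun_prop) (by fun_prop)]
  simp only [integral_const_mul]
  rw [integral_monomial_of_odd p 1 (by decide), integral_monomial_of_even,
    integral_monomial_of_even, hr]
  simp only [zero_add, add_zero, mul_zero, mul_one, pow_zero, integral_const, probReal_univ,
    smul_eq_mul]
  rw [integral_sq_gammaMeasure p.α_pos p.β_pos, integral_pow_one_gammaMeasure p.α_pos p.β_pos,
    integral_sq_gaussianReal]
  ring

theorem integral_scaledSq_sq (p : Prior) (u : ℝ × ℝ) :
    ∫ θ, scaledSq u θ ^ 2 ∂normalGamma p
      = (u.1 ^ 2 * p.μ₀ ^ 2 + u.2 ^ 2 / 4) ^ 2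
            * (p.α * (p.α + 1) * (p.α + 2) * (p.α + 3) / p.β ^ 4)
        + (6 * u.1 ^ 4 * p.μ₀ ^ 2 + u.1 ^ 2 * u.2 ^ 2 / 2) / p.κ
            * (p.α * (p.α + 1) * (p.α + 2) / p.β ^ 3)
        + 3 * u.1 ^ 4 / p.κ ^ 2 * (p.α * (p.α + 1) / p.β ^ 2) := by
  have hr := inv_sqrt_sq p
  set r := (Real.sqrt p.κ)⁻¹
  have hr4 : r ^ 4 = 1 / p.κ ^ 2 := by
    rw [show r ^ 4 = (r ^ 2) ^ 2 by ring, hr]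
    ring
  rw [integral_normalGamma p ((measurable_scaledSq u).pow_const 2)]
  have e : ∀ᵐ x ∂standardLaw p, scaledSq u (standardMap p x) ^ 2
      = (u.1 ^ 2 * p.μ₀ ^ 2 + u.2 ^ 2 / 4) ^ 2 * monomial 4 (2 * 0) x
        + 4 * u.1 ^ 2 * p.μ₀ * r * (u.1 ^ 2 * p.μ₀ ^ 2 + u.2 ^ 2 / 4) * monomial 3 1 x
        + (6 * u.1 ^ 4 * p.μ₀ ^ 2 + u.1 ^ 2 * u.2 ^ 2 / 2) * r ^ 2 * monomial 2 (2 * 1) x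
        + 4 * u.1 ^ 4 * p.μ₀ * r ^ 3 * monomial 1 3 x
        + u.1 ^ 4 * r ^ 4 * monomial 0 (2 * 2) x := by
    filter_upwards [ae_standardLaw_pos p] with x hx
    rw [scaledSq, η₁_standardMap p hx, η₂_standardMap]
    simp only [monomial]
    ring
  have h40 := integrable_monomial p 4 (2 * 0)
  have h31 := integrable_monomial p 3 1
  have h22 := integrable_monomial p 2 (2 * 1)
  have h13 := integrable_monomial p 1 3
  have h04 := integrable_monomial p 0 (2 * 2)
  rw [integral_congr_ae e, integral_add (by fun_prop) (by fun_prop),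
    integral_add (by fun_prop) (by fun_prop), integral_add (by fun_prop) (by fun_prop),
    integral_add (by fun_prop) (by fun_prop)]
  simp only [integral_const_mul]
  rw [integral_monomial_of_odd p 3 (by decide), integral_monomial_of_odd p 1 (by decide),
    integral_monomial_of_even, integral_monomial_of_even, integral_monomial_of_even, hr, hr4]
  simp only [zero_add, add_zero, mul_zero, mul_one, pow_zero, integral_const, probReal_univ,
    smul_eq_mul, Nat.reduceAdd, Nat.reduceMul]
  rw [integral_sq_gammaMeasure p.α_pos p.β_pos, integral_pow_three_gammaMeasure p.α_pos p.β_pos,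
    integral_pow_four_gammaMeasure p.α_pos p.β_pos,
    integral_sq_gaussianReal, integral_pow_four_gaussianReal]
  ring

/-! ### Exponential moments of the canonical parameter. -/

/-- The `ℓ¹` length of the canonical parameter. -/
def paramLength (θ : ℝ × ℝ) : ℝ := |η₁ θ| + |η₂ θ|

theorem paramLength_nonneg (θ : ℝ × ℝ) : 0 ≤ paramLength θ := by unfold paramLength; positivity

theorem measurable_paramLength : Measurable paramLength := by
  have := measurable_η₁
  have := measurable_η₂
  unfold paramLength
  fun_prop

/-- The inequality `2xy ≤ x² + y²` splits the mixed term `√x.1 |x.2|` so that the exponential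
factors over the product law; the weight `1/4` stays below the Gaussian `1/2`. -/
theorem mul_paramLength_standardMap_le (p : Prior) {γ : ℝ} (hγ : 0 ≤ γ) {x : ℝ × ℝ}
    (hx : 0 < x.1) :
    γ * paramLength (standardMap p x)
      ≤ (γ * (|p.μ₀| + 1 / 2) + γ ^ 2 / p.κ) * x.1 + x.2 ^ 2 / 4 := by
  rw [paramLength, η₁_standardMap p hx, η₂_standardMap]
  have hr := inv_sqrt_sq p
  set r := (Real.sqrt p.κ)⁻¹ with hr'
  have hr0 : 0 ≤ r := by positivity
  have h1 : |p.μ₀ * x.1 + r * (Real.sqrt x.1 * x.2)|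
      ≤ |p.μ₀| * x.1 + r * Real.sqrt x.1 * |x.2| := by
    refine (abs_add_le _ _).trans (le_of_eq ?_)
    rw [abs_mul, abs_mul, abs_mul, abs_of_pos hx, abs_of_nonneg hr0,
      abs_of_nonneg (Real.sqrt_nonneg _)]
    ring
  have h2 : |-x.1 / 2| = x.1 / 2 := by
    rw [neg_div, abs_neg, abs_of_pos (by positivity)]
  have h3 : γ * (r * Real.sqrt x.1 * |x.2|) ≤ γ ^ 2 / p.κ * x.1 + x.2 ^ 2 / 4 := by
    have h4 := sq_nonneg (γ * r * Real.sqrt x.1 - |x.2| / 2)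
    have h5 : (γ * r * Real.sqrt x.1) ^ 2 = γ ^ 2 / p.κ * x.1 := by
      rw [mul_pow, mul_pow, Real.sq_sqrt hx.le, hr]
      ring
    have h6 : (|x.2| / 2) ^ 2 = x.2 ^ 2 / 4 := by rw [div_pow, sq_abs]; norm_num
    nlinarith
  rw [h2]
  nlinarith [mul_le_mul_of_nonneg_left h1 hγ]

theorem exp_mul_paramLength_standardMap_le (p : Prior) {γ : ℝ} (hγ : 0 ≤ γ) {x : ℝ × ℝ}
    (hx : 0 < x.1) :
    Real.exp (γ * paramLength (standardMap p x))
      ≤ Real.exp ((γ * (|p.μ₀| + 1 / 2) + γ ^ 2 / p.κ) * x.1) * Real.exp (x.2 ^ 2 / 4) := by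
  rw [← Real.exp_add]
  exact Real.exp_le_exp.2 (mul_paramLength_standardMap_le p hγ hx)

theorem integrable_exp_mul_paramLength (p : Prior) {γ : ℝ} (hγ : 0 ≤ γ)
    (h : γ * (|p.μ₀| + 1 / 2) + γ ^ 2 / p.κ < p.β) :
    Integrable (fun θ => Real.exp (γ * paramLength θ)) (normalGamma p) := by
  have hm := measurable_paramLength
  have hs := measurable_standardMap p
  rw [integrable_normalGamma_iff p (by fun_prop)]
  refine ((integrable_exp_mul_gammaMeasure p.α_pos p.β_pos h).mul_prod
    integrable_exp_sq_gaussianReal).mono' (Measurable.aestronglyMeasurable (by fun_prop)) ?_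
  filter_upwards [ae_standardLaw_pos p] with x hx
  rw [Real.norm_of_nonneg (Real.exp_pos _).le]
  exact exp_mul_paramLength_standardMap_le p hγ hx

theorem integral_exp_mul_paramLength_le (p : Prior) {γ : ℝ} (hγ : 0 ≤ γ)
    (h : γ * (|p.μ₀| + 1 / 2) + γ ^ 2 / p.κ ≤ p.β / 2) :
    ∫ θ, Real.exp (γ * paramLength θ) ∂normalGamma p
      ≤ Real.exp (2 * (γ * (|p.μ₀| + 1 / 2) + γ ^ 2 / p.κ) * (p.α / p.β))
        * ∫ z : ℝ, Real.exp (z ^ 2 / 4) ∂gaussianReal 0 1 := by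
  have hm := measurable_paramLength
  have hs := measurable_standardMap p
  have hβ := p.β_pos
  have hκ := p.κ_pos
  have hlt : γ * (|p.μ₀| + 1 / 2) + γ ^ 2 / p.κ < p.β := by linarith
  have hint := integrable_exp_mul_paramLength p hγ hlt
  rw [integrable_normalGamma_iff p (by fun_prop)] at hint
  rw [integral_normalGamma p (by fun_prop)]
  calc _ ≤ ∫ x, Real.exp ((γ * (|p.μ₀| + 1 / 2) + γ ^ 2 / p.κ) * x.1) * Real.exp (x.2 ^ 2 / 4)
          ∂standardLaw p := by
        refine integral_mono_ae hint ((integrable_exp_mul_gammaMeasure p.α_pos p.β_pos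
          hlt).mul_prod integrable_exp_sq_gaussianReal) ?_
        filter_upwards [ae_standardLaw_pos p] with x hx
        exact exp_mul_paramLength_standardMap_le p hγ hx
    _ ≤ _ := by
        rw [standardLaw, integral_prod_mul (fun l : ℝ =>
          Real.exp ((γ * (|p.μ₀| + 1 / 2) + γ ^ 2 / p.κ) * l)) (fun z : ℝ => Real.exp (z ^ 2 / 4))]
        exact mul_le_mul_of_nonneg_right (integral_exp_mul_gammaMeasure_le p.α_pos p.β_pos
          (by positivity) h) (integral_nonneg fun z => (Real.exp_pos _).le)

/-! ### The likelihood ratio averaged over the region. -/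

/-- The average likelihood ratio over the acceptance region. -/
def tiltWeight (u θ : ℝ × ℝ) : ℝ :=
  diskAverage fun x => Real.exp (u.1 * η₁ θ * x.1 + u.2 * η₂ θ * x.2)

theorem measurable_tiltWeight (u : ℝ × ℝ) : Measurable (tiltWeight u) := by
  have := measurable_η₁
  have := measurable_η₂
  have h : StronglyMeasurable fun z : (ℝ × ℝ) × (ℝ × ℝ) =>
      Real.exp (u.1 * η₁ z.1 * z.2.1 + u.2 * η₂ z.1 * z.2.2) :=
    Measurable.stronglyMeasurable (by fun_prop)
  exact (h.integral_prod_right' (ν := volume.restrict unitDisk)).measurable.const_mul _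

theorem diskBounds_tiltWeight (u θ : ℝ × ℝ) : DiskBounds (scaledSq u θ) (tiltWeight u θ) :=
  diskBounds_diskAverage_exp _ _

theorem scaledSq_le {u : ℝ × ℝ} {ρ : ℝ} (h : u.1 ^ 2 + u.2 ^ 2 = ρ ^ 2) (θ : ℝ × ℝ) :
    scaledSq u θ ≤ (ρ * paramLength θ) ^ 2 := by
  have h1 := sq_abs (η₁ θ)
  have h2 := sq_abs (η₂ θ)
  have h3 := mul_nonneg (abs_nonneg (η₁ θ)) (abs_nonneg (η₂ θ))
  rw [scaledSq, paramLength, mul_pow, mul_pow, mul_pow, ← h, ← h1, ← h2]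
  nlinarith [mul_nonneg (sq_nonneg u.1) (sq_nonneg |η₂ θ|),
    mul_nonneg (sq_nonneg u.2) (sq_nonneg |η₁ θ|), mul_nonneg (sq_nonneg u.1) h3,
    mul_nonneg (sq_nonneg u.2) h3]

/-- Fubini on disk times parameter space: by Cauchy–Schwarz the integrand is at most `exp √s`,
whatever the point of the disk. -/
theorem integral_tiltWeight (p : Prior) (u : ℝ × ℝ)
    (h : Integrable (fun θ => Real.exp (Real.sqrt (scaledSq u θ))) (normalGamma p)) :
    diskAverage (fun x => ∫ θ, Real.exp (u.1 * η₁ θ * x.1 + u.2 * η₂ θ * x.2) ∂normalGamma p)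
      = ∫ θ, tiltWeight u θ ∂normalGamma p := by
  have := measurable_η₁
  have := measurable_η₂
  have hfin : IsFiniteMeasure (volume.restrict unitDisk) :=
    ⟨by simpa using isCompact_unitDisk.measure_lt_top⟩
  simp only [tiltWeight, diskAverage]
  rw [integral_const_mul, integral_integral_swap]
  refine ((integrable_const (1 : ℝ)).mul_prod h).mono'
    (Measurable.aestronglyMeasurable (by unfold Function.uncurry; fun_prop)) ?_
  have hD : ∀ᵐ z ∂(volume.restrict unitDisk).prod (normalGamma p), z.1 ∈ unitDisk :=
    Measure.quasiMeasurePreserving_fst.ae (ae_restrict_mem measurableSet_unitDisk)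
  filter_upwards [hD] with z hz
  rw [Real.norm_of_nonneg (by unfold Function.uncurry; positivity), one_mul]
  exact Real.exp_le_exp.2 ((le_abs_self _).trans (abs_linear_le_sqrt hz))

/-! ### Conjugacy and the approximate posterior as a tilting. -/

theorem βn_ge (p : Prior) (n : ℕ) (τ : ℝ × ℝ) :
    p.β + n * (τ.2 - τ.1 ^ 2) / 2 ≤ βn p n τ := by
  have hκ := p.κ_pos
  have h : 0 ≤ p.κ * n / (2 * (p.κ + n)) * (τ.1 - p.μ₀) ^ 2 := by positivity
  unfold βn
  linarith

theorem β_le_βn (p : Prior) (n : ℕ) {τ : ℝ × ℝ} (hτ : τ.1 ^ 2 < τ.2) : p.β ≤ βn p n τ := by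
  have h : 0 ≤ (n : ℝ) * (τ.2 - τ.1 ^ 2) := mul_nonneg (by positivity) (by linarith)
  linarith [βn_ge p n τ]

/-- The hyperparameters of the posterior. -/
def update (p : Prior) (n : ℕ) (τ : ℝ × ℝ) (hτ : τ.1 ^ 2 < τ.2) : Prior where
  μ₀ := μn p n τ
  κ := κn p n
  α := αn p n
  β := βn p n τ
  κ_pos := by have := p.κ_pos; unfold κn; positivity
  α_pos := by have := p.α_pos; unfold αn; positivity
  β_pos := p.β_pos.trans_le (β_le_βn p n hτ)

theorem priorDensity_of_pos (p : Prior) (m : ℝ) {l : ℝ} (hl : 0 < l) :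
    priorDensity p (m, l)
      = (Real.sqrt (2 * Real.pi))⁻¹ * Real.sqrt p.κ * (p.β ^ p.α / Real.Gamma p.α)
        * Real.exp ((p.α - 1 / 2) * Real.log l - p.κ * l * (m - p.μ₀) ^ 2 / 2 - p.β * l) := by
  have hκ := p.κ_pos
  have hs : Real.sqrt l = Real.exp (Real.log l / 2) := by
    rw [Real.sqrt_eq_rpow, Real.rpow_def_of_pos hl]
    ring_nf
  have hv : (((p.κ * l)⁻¹.toNNReal : NNReal) : ℝ) = (p.κ * l)⁻¹ :=
    Real.coe_toNNReal _ (by positivity)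
  have hq : (Real.sqrt (2 * Real.pi * (p.κ * l)⁻¹))⁻¹
      = (Real.sqrt (2 * Real.pi))⁻¹ * Real.sqrt p.κ * Real.exp (Real.log l / 2) := by
    rw [Real.sqrt_mul (by positivity), Real.sqrt_inv, Real.sqrt_mul hκ.le, hs, mul_inv, inv_inv]
    ring
  simp only [priorDensity, gaussianPDFReal, gammaPDFReal, hv, hq, if_pos hl.le]
  rw [Real.rpow_def_of_pos hl,
    show (p.α - 1 / 2) * Real.log l - p.κ * l * (m - p.μ₀) ^ 2 / 2 - p.β * l
      = Real.log l / 2 + -(m - p.μ₀) ^ 2 / (2 * (p.κ * l)⁻¹) + Real.log l * (p.α - 1)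
        + -(p.β * l) by field_simp; ring,
    Real.exp_add, Real.exp_add, Real.exp_add]
  ring

/-- At `l = 0` the gamma density need not vanish; there the Gaussian factor does, its variance being
`0` by the convention `0⁻¹ = 0`. -/
theorem priorDensity_of_nonpos (p : Prior) (m : ℝ) {l : ℝ} (hl : l ≤ 0) :
    priorDensity p (m, l) = 0 := by
  have h : (p.κ * l)⁻¹.toNNReal = 0 :=
    Real.toNNReal_eq_zero.2 (inv_nonpos.2 (mul_nonpos_of_nonneg_of_nonpos p.κ_pos.le hl))
  simp only [priorDensity, h, gaussianPDFReal_zero_var, Pi.zero_apply, zero_mul]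

/-- The value of the marginal density. -/
def evidence (p : Prior) (n : ℕ) (τ : ℝ × ℝ) : ℝ :=
  (2 * Real.pi) ^ (-(n : ℝ) / 2) * (Real.sqrt p.κ / Real.sqrt (κn p n))
    * (p.β ^ p.α / Real.Gamma p.α) * (Real.Gamma (αn p n) / βn p n τ ^ αn p n)

theorem evidence_pos (p : Prior) (n : ℕ) {τ : ℝ × ℝ} (hτ : τ.1 ^ 2 < τ.2) :
    0 < evidence p n τ := by
  have h1 := p.κ_pos
  have h2 := p.β_pos
  have h3 := Real.Gamma_pos_of_pos p.α_pos
  have h4 : 0 < κn p n := (update p n τ hτ).κ_pos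
  have h5 : 0 < βn p n τ := (update p n τ hτ).β_pos
  have h6 : 0 < Real.Gamma (αn p n) := Real.Gamma_pos_of_pos (update p n τ hτ).α_pos
  unfold evidence
  positivity

theorem jointDensity_eq (p : Prior) (n : ℕ) {τ : ℝ × ℝ} (hτ : τ.1 ^ 2 < τ.2) (θ : ℝ × ℝ) :
    jointDensity p n τ θ = evidence p n τ * priorDensity (update p n τ hτ) θ := by
  obtain ⟨m, l⟩ := θ
  rcases le_or_gt l 0 with hl | hl
  · rw [jointDensity, priorDensity_of_nonpos _ _ hl, priorDensity_of_nonpos _ _ hl, mul_zero,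
      mul_zero]
  · have h3 := (Real.Gamma_pos_of_pos p.α_pos).ne'
    have h4 : 0 < κn p n := (update p n τ hτ).κ_pos
    have h5 : 0 < βn p n τ := (update p n τ hτ).β_pos
    have h6 : 0 < Real.Gamma (αn p n) := Real.Gamma_pos_of_pos (update p n τ hτ).α_pos
    have h7 := Real.rpow_pos_of_pos h5 (αn p n)
    have h8 := Real.sqrt_pos.2 h4
    have hκn : 0 < p.κ + n := h4
    rw [jointDensity, priorDensity_of_pos _ _ hl, priorDensity_of_pos _ _ hl, evidence, likelihood]
    -- Completing the square in `m`.
    have hexp : n * (η₁ (m, l) * τ.1 + η₂ (m, l) * τ.2) - n * logPartition (m, l)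
        + ((p.α - 1 / 2) * Real.log l - p.κ * l * (m - p.μ₀) ^ 2 / 2 - p.β * l)
        = (αn p n - 1 / 2) * Real.log l - κn p n * l * (m - μn p n τ) ^ 2 / 2 - βn p n τ * l := by
      simp only [η₁, η₂, logPartition, αn, κn, μn, βn]
      field_simp
      ring
    simp only [update]
    rw [← hexp, Real.exp_add]
    field_simp

theorem jointDensity_shift (p : Prior) (n : ℕ) (ε τ x θ : ℝ × ℝ) :
    jointDensity p n (regionMap ε τ x) θ = jointDensity p n τ θ
      * Real.exp (n * ε.1 * η₁ θ * x.1 + n * ε.2 * η₂ θ * x.2) := by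
  simp only [jointDensity, likelihood, regionMap]
  rw [show n * (η₁ θ * (τ.1 + ε.1 * x.1) + η₂ θ * (τ.2 + ε.2 * x.2)) - n * logPartition θ
    = (n * (η₁ θ * τ.1 + η₂ θ * τ.2) - n * logPartition θ)
      + (n * ε.1 * η₁ θ * x.1 + n * ε.2 * η₂ θ * x.2) by ring, Real.exp_add]
  ring

theorem integral_priorDensity_mul (p : Prior) (g : ℝ × ℝ → ℝ) :
    ∫ θ, priorDensity p θ * g θ = ∫ θ, g θ ∂normalGamma p := by
  have := measurable_priorDensity p
  rw [normalGamma, integral_withDensity_eq_integral_toReal_smul (by fun_prop) (by simp)]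
  simp only [ENNReal.toReal_ofReal (priorDensity_nonneg p _), smul_eq_mul]

theorem marginalDensity_eq (p : Prior) (n : ℕ) {τ : ℝ × ℝ} (hτ : τ.1 ^ 2 < τ.2) :
    marginalDensity p n τ = evidence p n τ := by
  have h := integral_priorDensity_mul (update p n τ hτ) fun _ => 1
  simp only [mul_one, integral_const, probReal_univ, smul_eq_mul] at h
  simp_rw [marginalDensity, jointDensity_eq p n hτ, integral_const_mul, h, mul_one]

/-- The closed form `evidence` is used only at the centre: a point of the ellipse may violate `τ.1²
< τ.2`. -/
theorem marginalDensity_shift (p : Prior) (n : ℕ) {τ : ℝ × ℝ} (hτ : τ.1 ^ 2 < τ.2)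
    (ε x : ℝ × ℝ) :
    marginalDensity p n (regionMap ε τ x) = evidence p n τ
      * ∫ θ, Real.exp (n * ε.1 * η₁ θ * x.1 + n * ε.2 * η₂ θ * x.2)
          ∂normalGamma (update p n τ hτ) := by
  simp_rw [marginalDensity, jointDensity_shift, jointDensity_eq p n hτ, mul_assoc,
    integral_const_mul]
  rw [integral_priorDensity_mul]

theorem posterior_eq (p : Prior) (n : ℕ) {τ : ℝ × ℝ} (hτ : τ.1 ^ 2 < τ.2) :
    posterior p n τ = normalGamma (update p n τ hτ) := by
  have hZ := (evidence_pos p n hτ).ne'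
  simp_rw [posterior, posteriorDensity, marginalDensity_eq p n hτ, jointDensity_eq p n hτ,
    mul_div_cancel_left₀ _ hZ]
  rfl

theorem diskAverage_const_mul (c : ℝ) (f : ℝ × ℝ → ℝ) :
    diskAverage (fun x => c * f x) = c * diskAverage f := by
  rw [diskAverage, diskAverage, integral_const_mul]
  ring

theorem abcPosterior_eq_tilted (p : Prior) (n : ℕ) {ε τ : ℝ × ℝ} (hτ : τ.1 ^ 2 < τ.2)
    (h1 : 0 < ε.1) (h2 : 0 < ε.2)
    (h : Integrable (fun θ => Real.exp (Real.sqrt (scaledSq (n * ε.1, n * ε.2) θ)))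
      (normalGamma (update p n τ hτ))) :
    abcPosterior p n ε τ = (normalGamma (update p n τ hτ)).tilted
      fun θ => Real.log (tiltWeight (n * ε.1, n * ε.2) θ) := by
  have hZ := (evidence_pos p n hτ).ne'
  have hpos : ∀ θ, 0 < tiltWeight (n * ε.1, n * ε.2) θ := fun θ =>
    zero_lt_one.trans_le ((diskBounds_tiltWeight _ θ).one_le (scaledSq_nonneg _ θ))
  have hpd := measurable_priorDensity (update p n τ hτ)
  have hA := measurable_tiltWeight (n * ε.1, n * ε.2)
  have hint := integral_tiltWeight _ _ h
  have hdens : ∀ θ, abcDensity p n ε τ θ = priorDensity (update p n τ hτ) θ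
      * (tiltWeight (n * ε.1, n * ε.2) θ
        / ∫ θ, tiltWeight (n * ε.1, n * ε.2) θ ∂normalGamma (update p n τ hτ)) := fun θ => by
    rw [abcDensity, regionAverage_eq_diskAverage h1 h2, regionAverage_eq_diskAverage h1 h2]
    simp_rw [jointDensity_shift, marginalDensity_shift p n hτ, diskAverage_const_mul]
    rw [← hint, jointDensity_eq p n hτ]
    simp only [tiltWeight]
    rw [mul_assoc, mul_div_mul_left _ _ hZ, mul_div_assoc]
  simp_rw [Measure.tilted, Real.exp_log (hpos _), normalGamma]
  rw [← withDensity_mul _ (by fun_prop) (by fun_prop), abcPosterior]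
  congr 1 with θ
  rw [hdens, ENNReal.ofReal_mul (priorDensity_nonneg _ _)]
  rfl

/-- For instance, `(a + 2)(a + 3) - a(a + 1) = 4a + 6` produces the factor in the pure `λ²` terms.
-/
theorem variance_scaledSq_eq_leadingTerm (p : Prior) (n : ℕ) (ε : ℝ × ℝ) {τ : ℝ × ℝ}
    (hτ : τ.1 ^ 2 < τ.2) :
    (∫ θ, scaledSq (n * ε.1, n * ε.2) θ ^ 2 ∂normalGamma (update p n τ hτ)
      - (∫ θ, scaledSq (n * ε.1, n * ε.2) θ ∂normalGamma (update p n τ hτ)) ^ 2) / 128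
      = leadingTerm p n ε τ := by
  have hk : κn p n ≠ 0 := (update p n τ hτ).κ_pos.ne'
  have hb : βn p n τ ≠ 0 := (update p n τ hτ).β_pos.ne'
  rw [integral_scaledSq, integral_scaledSq_sq]
  simp only [update, leadingTerm]
  field_simp
  ring

/-! ### Bounds uniform in the sample size. -/

theorem abs_μn_le (p : Prior) (n : ℕ) (τ : ℝ × ℝ) : |μn p n τ| ≤ |p.μ₀| + |τ.1| := by
  have hκ := p.κ_pos
  have hn : (0 : ℝ) ≤ n := by positivity
  rw [μn, abs_div, abs_of_pos (show 0 < p.κ + n by positivity), div_le_iff₀ (by positivity)]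
  have h := abs_add_le (p.κ * p.μ₀) (n * τ.1)
  rw [abs_mul, abs_mul, abs_of_pos hκ, abs_of_nonneg hn] at h
  nlinarith [mul_nonneg hn (abs_nonneg p.μ₀), mul_nonneg hκ.le (abs_nonneg τ.1)]

/-- Split `αn = α + n/2` and use `βn ≥ β` for the first summand, `βn ≥ n (τ.2 - τ.1²) / 2` for the
second. -/
theorem αn_div_βn_le (p : Prior) (n : ℕ) {τ : ℝ × ℝ} (hτ : τ.1 ^ 2 < τ.2) :
    αn p n / βn p n τ ≤ p.α / p.β + 1 / (τ.2 - τ.1 ^ 2) := by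
  have hv : 0 < τ.2 - τ.1 ^ 2 := by linarith
  have hα := p.α_pos
  have hβ := p.β_pos
  have h1 := βn_ge p n τ
  have hb : 0 < βn p n τ := hβ.trans_le (β_le_βn p n hτ)
  have hn : 0 ≤ n * (τ.2 - τ.1 ^ 2) / 2 := by positivity
  rw [αn, add_div]
  refine add_le_add (div_le_div_of_nonneg_left hα.le hβ (by linarith)) ?_
  rw [div_le_div_iff₀ hb hv]
  linarith

/-- The relative entropy of a measure with respect to its tilting. -/
theorem klDiv_tilted {Ω : Type*} [MeasurableSpace Ω] (P : Measure Ω) [IsProbabilityMeasure P]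
    {f : Ω → ℝ} (hf : Integrable f P) (hexp : Integrable (fun ω => Real.exp (f ω)) P) :
    InformationTheory.klDiv P (P.tilted f) ≠ ⊤ ∧
      (InformationTheory.klDiv P (P.tilted f)).toReal
        = Real.log (∫ ω, Real.exp (f ω) ∂P) - ∫ ω, f ω ∂P := by
  have hac : P ≪ P.tilted f := absolutelyContinuous_tilted hexp
  have := isProbabilityMeasure_tilted hexp
  have h0 : Integrable (llr P P) P := (integrable_zero _ _ _).congr (llr_self P).symm
  refine ⟨InformationTheory.klDiv_ne_top hac
    (integrable_llr_tilted_right Measure.AbsolutelyContinuous.rfl hf h0 hexp), ?_⟩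
  rw [InformationTheory.toReal_klDiv_of_measure_eq hac (by simp),
    integral_llr_tilted_right Measure.AbsolutelyContinuous.rfl hf hexp h0,
    integral_congr_ae (llr_self P)]
  simp
  ring

/-- Exponential moments of the canonical parameter are bounded along the posteriors. -/
theorem exists_exp_moment_bound (p : Prior) {τ : ℝ × ℝ} (hτ : τ.1 ^ 2 < τ.2) :
    ∃ c K : ℝ, 0 < c ∧ ∀ n : ℕ,
      Integrable (fun θ => Real.exp (2 * c * paramLength θ)) (normalGamma (update p n τ hτ)) ∧
      ∫ θ, Real.exp (2 * c * paramLength θ) ∂normalGamma (update p n τ hτ) ≤ K := by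
  have hκ := p.κ_pos
  have hβ := p.β_pos
  set L := |p.μ₀| + |τ.1| + 1 / 2 + 1 / p.κ with hL
  have hL0 : 0 < L := by positivity
  -- `γ ≤ 1` gives `γ² ≤ γ`, so the gamma rate is at most `γ L ≤ β/2`, hence at most half of every
  -- updated rate.
  set γ := min 1 (p.β / 2 / L) with hγ
  have hγ0 : 0 < γ := lt_min one_pos (by positivity)
  have hγ1 : γ ≤ 1 := min_le_left _ _
  have hγL : γ * L ≤ p.β / 2 := (le_div_iff₀ hL0).1 (min_le_right _ _)
  refine ⟨γ / 2, Real.exp (p.β * (p.α / p.β + 1 / (τ.2 - τ.1 ^ 2)))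
    * ∫ z : ℝ, Real.exp (z ^ 2 / 4) ∂gaussianReal 0 1, by positivity, fun n => ?_⟩
  rw [show 2 * (γ / 2) = γ by ring]
  set q := update p n τ hτ
  have hrate : γ * (|q.μ₀| + 1 / 2) + γ ^ 2 / q.κ ≤ p.β / 2 := by
    have hm : |q.μ₀| ≤ |p.μ₀| + |τ.1| := abs_μn_le p n τ
    have hk : γ ^ 2 / q.κ ≤ γ * (1 / p.κ) := by
      have hkk : p.κ ≤ q.κ := by
        change p.κ ≤ p.κ + n
        linarith [(Nat.cast_nonneg n : (0 : ℝ) ≤ n)]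
      calc γ ^ 2 / q.κ ≤ γ ^ 2 / p.κ := div_le_div_of_nonneg_left (by positivity) hκ hkk
        _ = γ * (γ / p.κ) := by ring
        _ ≤ γ * (1 / p.κ) := by gcongr
    have := mul_le_mul_of_nonneg_left hm hγ0.le
    rw [hL] at hγL
    linarith
  have hβq : p.β ≤ q.β := β_le_βn p n hτ
  have hnn : 0 ≤ γ * (|q.μ₀| + 1 / 2) + γ ^ 2 / q.κ := by
    have := q.κ_pos
    positivity
  refine ⟨integrable_exp_mul_paramLength q hγ0.le (by linarith),
    (integral_exp_mul_paramLength_le q hγ0.le (by linarith)).trans ?_⟩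
  refine mul_le_mul_of_nonneg_right (Real.exp_le_exp.2 ?_)
    (integral_nonneg fun z => (Real.exp_pos _).le)
  have hq : 0 ≤ q.α / q.β := div_nonneg q.α_pos.le q.β_pos.le
  exact mul_le_mul (by linarith) (αn_div_βn_le p n hτ) hq hβ.le

end

end NormalABC

/-! ### The entropy expansion. -/

open NormalABC in
theorem mainTheorem8 (p : NormalABC.Prior) (τ : ℝ × ℝ) (hτ : τ.1 ^ 2 < τ.2) :
    ∃ C : ℝ, 0 < C ∧ ∃ δ : ℝ, 0 < δ ∧
      ∀ n : ℕ, 1 ≤ n → ∀ ε : ℝ × ℝ, 0 < ε.1 → 0 < ε.2 →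
        (n : ℝ) * Real.sqrt (ε.1 ^ 2 + ε.2 ^ 2) ≤ δ →
          IsProbabilityMeasure (posterior p n τ) ∧
          IsProbabilityMeasure (abcPosterior p n ε τ) ∧
          InformationTheory.klDiv (posterior p n τ) (abcPosterior p n ε τ) ≠ ⊤ ∧
          |(InformationTheory.klDiv (posterior p n τ) (abcPosterior p n ε τ)).toReal
              - leadingTerm p n ε τ|
            ≤ C * ((n : ℝ) * Real.sqrt (ε.1 ^ 2 + ε.2 ^ 2)) ^ 6 := by
  obtain ⟨c, K, hc, hK⟩ := exists_exp_moment_bound p hτ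
  have hK0 : 0 ≤ K := (integral_nonneg fun θ => (Real.exp_pos _).le).trans (hK 0).2
  set B := 2 / c ^ 2 * K + 24 / c ^ 4 * K + 720 / c ^ 6 * K + 1 with hB
  have hK1 : 0 ≤ 2 / c ^ 2 * K := by positivity
  have hK2 : 0 ≤ 24 / c ^ 4 * K := by positivity
  have hK3 : 0 ≤ 720 / c ^ 6 * K := by positivity
  have hB0 : 0 < B := by positivity
  -- Taking `δ = c` makes `n|ε| ≤ δ` the condition `ρ ≤ c` of `Controlled`.
  refine ⟨3 * B + (B * (1 + c ^ 2 + c ^ 4)) ^ 2 + 2 * (B * (1 + c ^ 2 + c ^ 4)) ^ 3,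
    by positivity, c, hc, fun n _ ε h1 h2 hδ => ?_⟩
  set ρ := (n : ℝ) * Real.sqrt (ε.1 ^ 2 + ε.2 ^ 2) with hρ
  have hρ2 : (n * ε.1) ^ 2 + (n * ε.2) ^ 2 = ρ ^ 2 := by
    rw [hρ, mul_pow _ (Real.sqrt _), Real.sq_sqrt (by positivity)]
    ring
  have hctl : Controlled (normalGamma (update p n τ hτ)) c K ρ paramLength
      (scaledSq (n * ε.1, n * ε.2)) (tiltWeight (n * ε.1, n * ε.2)) :=
    { ρ_nonneg := by positivity
      ρ_le := hδ
      W_nonneg := paramLength_nonneg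
      s_nonneg := scaledSq_nonneg _
      s_le := scaledSq_le hρ2
      bounds := diskBounds_tiltWeight _
      measurable_s := measurable_scaledSq _
      measurable_A := measurable_tiltWeight _
      integrable_exp := (hK n).1
      integral_exp_le := (hK n).2 }
  have hsqrt : MeasureTheory.Integrable
      (fun θ => Real.exp (Real.sqrt (scaledSq (n * ε.1, n * ε.2) θ)))
      (normalGamma (update p n τ hτ)) := by
    simpa using hctl.integrable_pow_mul_exp hc 0
  have hpos : ∀ θ, 0 < tiltWeight (n * ε.1, n * ε.2) θ := fun θ =>
    zero_lt_one.trans_le ((diskBounds_tiltWeight _ θ).one_le (scaledSq_nonneg _ θ))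
  have hexp : ∀ θ, Real.exp (Real.log (tiltWeight (n * ε.1, n * ε.2) θ))
      = tiltWeight (n * ε.1, n * ε.2) θ := fun θ => Real.exp_log (hpos θ)
  have hint : MeasureTheory.Integrable
      (fun θ => Real.exp (Real.log (tiltWeight (n * ε.1, n * ε.2) θ)))
      (normalGamma (update p n τ hτ)) := by
    simpa only [hexp] using hctl.integrable_A hc
  obtain ⟨hfin, hkl⟩ := klDiv_tilted _ (hctl.integrable_log hc) hint
  rw [posterior_eq p n hτ, abcPosterior_eq_tilted p n hτ h1 h2 hsqrt]
  refine ⟨inferInstance, MeasureTheory.isProbabilityMeasure_tilted hint, hfin, ?_⟩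
  rw [hkl, ← variance_scaledSq_eq_leadingTerm p n ε hτ]
  simp only [hexp]
  exact hctl.abs_log_integral_sub_le hc (by linarith) (by linarith) (by linarith)
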